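/- **Setting.** Let $K\ge 2$, $[n]=\{1,\dots,n\}$, and let $\nu=(\nu_k)_{k\in[K]}$ be probability laws on $\mathbb R$ with means $\mu=(\mu_k)_{k\in[K]}$ that are $1$-sub-Gaussian: $\mathbb E_{X\sim\nu_k}[e^{\lambda(X-\mu_k)}]\le e^{\lambda^2/2}$ for all $\lambda\in\mathbb R$. Put $\mu_\star=\max_k\mu_k$, $i^\star(\mu)=\{k:\mu_k=\mu_\star\}$ and $\mathcal I_\varepsilon(\mu)=\{k:\mu_k\ge\mu_\star-\varepsilon\}$. At each time $n\ge 1$ an arm $I_n$ is pulled and a reward $X_n$ is observed whose conditional law, given $\mathcal F_n=\sigma((I_t,X_t):1\le t<n)$ and $I_n$, is $\nu_{I_n}$. Let $N_{n,k}$ be the number of pulls of arm $k$ before time $n$ and $\mu_{n,k}$ the average of the rewards obtained from these pulls. **Algorithm** EB-TC$_{\varepsilon_0}$ with slack $\varepsilon_0>0$ and fixed proportion $\beta=1/2$. During the first $K$ rounds each arm is pulled once. At each time $n>K$ the recommendation and leader is $\hat\imath_n=B_n\in\arg\max_k\mu_{n,k}$ and the challenger is $$C_n\in\arg\min_{k\ne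 B_n}\frac{\mu_{n,B_n}-\mu_{n,k}+\varepsilon_0}{\sqrt{1/N_{n,B_n}+1/N_{n,k}}},$$ with ties broken arbitrarily. Let $T_n(i,j)$ be the number of $t$ with $K<t<n$ and $(B_t,C_t)=(i,j)$, and $N^i_{n,j}$ the number of those $t$ with, in addition, $I_t=j$. Then $I_n=C_n$ if $N^{B_n}_{n,C_n}\le\tfrac12 T_{n+1}(B_n,C_n)$, and $I_n=B_n$ otherwise. **Complexities.** Let $0=\Delta_1<\dots<\Delta_{C_\mu}$ be the distinct values of the gaps $\mu_\star-\mu_k$, $C_\mu=|\{\mu_k:k\in[K]\}|$, and $\mathcal C_\mu(i)=\{k:\mu_\star-\mu_k=\Delta_i\}$. For $\varepsilon\ge0$ let $i_\mu(\varepsilon)=i$ if $\varepsilon\in[\Delta_i,\Delta_{i+1})$ with $i\in[C_\mu-1]$, and $i_\mu(\varepsilon)=C_\mu$ otherwise. Let $C_i(\varepsilon_0)=2\Delta_i^{-1}-\varepsilon_0^{-1}$ and $C_{i,j}(\varepsilon_0)=2\frac{\Delta_j/\varepsilon_0+1}{\Delta_i-\Delta_j}+3\varepsilon_0^{-1}$.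 For $i\in[C_\mu-1]$ let $H_i(\mu,\varepsilon_0)=\min_{j\in[i]}\max\{\bar H_{i,j},\tilde H_{i,j}\}$, where $$\begin{aligned}\bar H_{i,j}={}&|i^\star(\mu)|\max\{\sqrt2\,\Delta_{j+1}^{-1},C_{i+1,j}(\varepsilon_0)\}^2+\max\{C_{j+1}(\varepsilon_0),C_{i+1,j}(\varepsilon_0)\}^2\Big(\sum_{k=2}^{j}|\mathcal C_\mu(k)|+\sum_{k=i+1}^{C_\mu}|\mathcal C_\mu(k)|\Big)\\&+\sum_{k=j+1}^{i}|\mathcal C_\mu(k)|\max\{C_{j+1}(\varepsilon_0),C_{i+1,j}(\varepsilon_0),\sqrt2\,\Delta_k^{-1}\}^2,\end{aligned}$$ $$\begin{aligned}\tilde H_{i,j}={}&\frac{2|i^\star(\mu)|}{\Delta_{j+1}^2}+\max\{C_{j+1}(\varepsilon_0),\varepsilon_0^{-1}\}^2\sum_{k=2}^{j}|\mathcal C_\mu(k)|+\frac{2\sum_{k=1}^{j}|\mathcal C_\mu(k)|}{(\Delta_{i+1}-\Delta_j)^2}\\&+\sum_{k=j+1}^{C_\mu}|\mathcal C_\mu(k)|\max\{C_{j+1}(\varepsilon_0),\varepsilon_0^{-1},\sqrt2\,\Delta_k^{-1}\}^2.\end{aligned}$$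 Let $\overline W_{-1}(x)=-W_{-1}(-e^{-x})$ for $x\ge1$, with $W_{-1}$ the negative branch of the Lambert function, $h_2(L,A,B)=2A\,\overline W_{-1}\big(\tfrac12L+\tfrac{B}{2A}+\log(2A)\big)$, and, for $i\in[C_\mu-1]$ and $\delta\in(0,1)$, $$U_{i,\delta}(\mu,\varepsilon_0)=h_2\big(\log(1/\delta),\,8H_i(\mu,\varepsilon_0),\,8H_i(\mu,\varepsilon_0)\log(K(K+1)/2)+5K^2/2\big).$$ Put $U_{C_\mu,\delta}(\mu,\varepsilon_0)=K$ (for $i_\mu(\varepsilon)=C_\mu$ all arms are $\varepsilon$-good, and recommendations start after time $K$). **Theorem.** For EB-TC$_{\varepsilon_0}$ with $\beta=1/2$, for all $\varepsilon_0>0$, all $\nu$ as above, all $\delta\in(0,1)$ and all $\varepsilon\ge0$ (neither $\varepsilon$ nor $\delta$ is a parameter of the algorithm): 1. $\mathbb P_\nu\big(\forall n>U_{i_\mu(\varepsilon),\delta}(\mu,\varepsilon_0):\ \hat\imath_n\in\mathcal I_\varepsilon(\mu)\big)\ge1-\delta$. 2. Consequently the $(\varepsilon,\delta)$-unverifiable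 sample complexity, i.e. the infimum of $\mathbb E_\nu[\tau]$ over stopping times $\tau>K$ of $(\mathcal F_n)_n$ with $\mathbb P_\nu(\forall n\ge\tau:\ \hat\imath_n\in\mathcal I_\varepsilon(\mu))\ge1-\delta$, is at most $\lfloor U_{i_\mu(\varepsilon),\delta}(\mu,\varepsilon_0)\rfloor+1$. 3. For all $A>0$ and $B\in\mathbb R$, $h_2(\log(1/\delta),A,B)=A\log(1/\delta)+O(\log\log(1/\delta))$ as $\delta\to0$; in particular, for all $i\in[C_\mu-1]$, $U_{i,\delta}(\mu,\varepsilon_0)=8H_i(\mu,\varepsilon_0)\log(1/\delta)+O(\log\log(1/\delta))$. -/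

import Mathlib

open MeasureTheory ProbabilityTheory Filter Topology Asymptotics
open scoped ENNReal NNReal

/-! ### Bandit instances: means, gaps and good arms. Arms are indexed by `Fin K`. -/

/-- The mean `μ_k` of each arm of the instance `ν`. -/
noncomputable def armMean {K : ℕ} (ν : Fin K → Measure ℝ) : Fin K → ℝ :=
  fun k => ∫ x, x ∂(ν k)

/-- A law on `ℝ` is `1`-sub-Gaussian: `E[exp (l (X - E X))] ≤ exp (l ^ 2 / 2)` for all real `l`
(with integrability of the exponentials). -/
def IsOneSubGaussian (ρ : Measure ℝ) : Prop :=
  HasSubgaussianMGF (fun x => x - ∫ y, y ∂ρ) 1 ρ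

/-- The largest mean `μ_⋆`. -/
noncomputable def maxMean {K : ℕ} (μ : Fin K → ℝ) : ℝ := ⨆ k, μ k

/-- The set `I_ε(μ)` of `ε`-good arms. -/
def goodArms {K : ℕ} (μ : Fin K → ℝ) (ε : ℝ) : Set (Fin K) := {k | maxMean μ - ε ≤ μ k}

/-- The set `i^⋆(μ)` of best arms. -/
noncomputable def bestArms {K : ℕ} (μ : Fin K → ℝ) : Finset (Fin K) :=
  Finset.univ.filter (fun k => μ k = maxMean μ)

/-- The number `C_μ` of distinct means. -/
noncomputable def numClasses {K : ℕ} (μ : Fin K → ℝ) : ℕ := (Finset.univ.image μ).card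

/-- The finite set of the gaps `μ_⋆ - μ_k`. -/
noncomputable def gapSet {K : ℕ} (μ : Fin K → ℝ) : Finset ℝ :=
  Finset.univ.image (fun k => maxMean μ - μ k)

theorem card_gapSet {K : ℕ} (μ : Fin K → ℝ) : (gapSet μ).card = numClasses μ := by
  have h : gapSet μ = (Finset.univ.image μ).image (fun x => maxMean μ - x) := by
    simp [gapSet, Finset.image_image, Function.comp_def]
  rw [h, numClasses]
  exact Finset.card_image_of_injective _ (fun a b hab => by simpa using hab)

/-- The distinct gaps `0 = Δ_1 < Δ_2 < ⋯ < Δ_{C_μ}` in increasing order; the index starts at `1`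
(and the value is irrelevant for indices outside `1, …, C_μ`). -/
noncomputable def sortedGap {K : ℕ} (μ : Fin K → ℝ) (i : ℕ) : ℝ :=
  if h : i - 1 < numClasses μ then (gapSet μ).orderEmbOfFin (card_gapSet μ) ⟨i - 1, h⟩ else 0

/-- The size of the class `C_μ(i)` of the arms whose gap is `Δ_i`. -/
noncomputable def classSize {K : ℕ} (μ : Fin K → ℝ) (i : ℕ) : ℕ :=
  (Finset.univ.filter (fun k => maxMean μ - μ k = sortedGap μ i)).card

/-- The indices `i ∈ [C_μ - 1]` such that `ε ∈ [Δ_i, Δ_{i+1})`. -/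
def classIndexSet {K : ℕ} (μ : Fin K → ℝ) (ε : ℝ) : Set ℕ :=
  {i | 1 ≤ i ∧ i < numClasses μ ∧ sortedGap μ i ≤ ε ∧ ε < sortedGap μ (i + 1)}

open Classical in
/-- The index `i_μ(ε)`: it is `i` if `ε ∈ [Δ_i, Δ_{i+1})` with `i ∈ [C_μ - 1]`, else `C_μ`. -/
noncomputable def classIndex {K : ℕ} (μ : Fin K → ℝ) (ε : ℝ) : ℕ :=
  if (classIndexSet μ ε).Nonempty then sInf (classIndexSet μ ε) else numClasses μ

/-! ### Complexities -/

/-- `C_i(ε₀) = 2 / Δ_i - 1 / ε₀`. -/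
noncomputable def cOne {K : ℕ} (μ : Fin K → ℝ) (ε₀ : ℝ) (i : ℕ) : ℝ :=
  2 * (sortedGap μ i)⁻¹ - ε₀⁻¹

/-- `C_{i,j}(ε₀) = 2 (Δ_j / ε₀ + 1) / (Δ_i - Δ_j) + 3 / ε₀`. -/
noncomputable def cTwo {K : ℕ} (μ : Fin K → ℝ) (ε₀ : ℝ) (i j : ℕ) : ℝ :=
  2 * ((sortedGap μ j / ε₀ + 1) / (sortedGap μ i - sortedGap μ j)) + 3 * ε₀⁻¹

/-- The complexity `\bar H_{i,j}(μ, ε₀)`. -/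
noncomputable def hBar {K : ℕ} (μ : Fin K → ℝ) (ε₀ : ℝ) (i j : ℕ) : ℝ :=
  ((bestArms μ).card : ℝ) *
      (max (Real.sqrt 2 * (sortedGap μ (j + 1))⁻¹) (cTwo μ ε₀ (i + 1) j)) ^ 2
    + (max (cOne μ ε₀ (j + 1)) (cTwo μ ε₀ (i + 1) j)) ^ 2 *
      ((∑ k ∈ Finset.Icc 2 j, (classSize μ k : ℝ))
        + ∑ k ∈ Finset.Icc (i + 1) (numClasses μ), (classSize μ k : ℝ))
    + ∑ k ∈ Finset.Icc (j + 1) i, (classSize μ k : ℝ) *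
      (max (max (cOne μ ε₀ (j + 1)) (cTwo μ ε₀ (i + 1) j))
        (Real.sqrt 2 * (sortedGap μ k)⁻¹)) ^ 2

/-- The complexity `\tilde H_{i,j}(μ, ε₀)`. -/
noncomputable def hTilde {K : ℕ} (μ : Fin K → ℝ) (ε₀ : ℝ) (i j : ℕ) : ℝ :=
  2 * ((bestArms μ).card : ℝ) / (sortedGap μ (j + 1)) ^ 2
    + (max (cOne μ ε₀ (j + 1)) ε₀⁻¹) ^ 2 * ∑ k ∈ Finset.Icc 2 j, (classSize μ k : ℝ)
    + 2 * (∑ k ∈ Finset.Icc 1 j, (classSize μ k : ℝ)) /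
        (sortedGap μ (i + 1) - sortedGap μ j) ^ 2
    + ∑ k ∈ Finset.Icc (j + 1) (numClasses μ), (classSize μ k : ℝ) *
      (max (max (cOne μ ε₀ (j + 1)) ε₀⁻¹) (Real.sqrt 2 * (sortedGap μ k)⁻¹)) ^ 2

/-- `H_i(μ, ε₀) = min_{j ∈ [i]} max {\bar H_{i,j}(μ, ε₀), \tilde H_{i,j}(μ, ε₀)}`,
for `i ∈ [C_μ - 1]`. -/
noncomputable def complexityH {K : ℕ} (μ : Fin K → ℝ) (ε₀ : ℝ) (i : ℕ) : ℝ :=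
  ⨅ j : Finset.Icc 1 i, max (hBar μ ε₀ i j) (hTilde μ ε₀ i j)

/-- The branch `W_{-1}` of the Lambert function: for `y ∈ [-1/e, 0)` it is the unique `w ≤ -1`
with `w * exp w = y`. -/
noncomputable def lambertWNegOne (y : ℝ) : ℝ :=
  Function.invFunOn (fun w : ℝ => w * Real.exp w) (Set.Iic (-1)) y

/-- `\bar W_{-1}(x) = - W_{-1}(- e^{-x})`, for `x ≥ 1`. -/
noncomputable def lambertWBar (x : ℝ) : ℝ := - lambertWNegOne (- Real.exp (-x))

/-- `h_2(L, A, B) = 2 A \bar W_{-1}(L / 2 + B / (2 A) + log (2 A))`. -/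
noncomputable def hTwo (L A B : ℝ) : ℝ :=
  2 * A * lambertWBar (1 / 2 * L + B / (2 * A) + Real.log (2 * A))

/-- The time `U_{i,δ}(μ, ε₀)` for `i ∈ [C_μ - 1]`. For `i = C_μ`, where all arms are good,
the value is `K`, the last time before recommendations start. -/
noncomputable def unverifiableTime {K : ℕ} (μ : Fin K → ℝ) (ε₀ : ℝ) (i : ℕ) (δ : ℝ) : ℝ :=
  if i < numClasses μ then
    hTwo (Real.log (1 / δ)) (8 * complexityH μ ε₀ i)
      (8 * complexityH μ ε₀ i * Real.log ((K : ℝ) * ((K : ℝ) + 1) / 2) + 5 * (K : ℝ) ^ 2 / 2)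
  else (K : ℝ)

/-! ### The algorithm. Times start at `1`; values of the processes at time `0` play no role. -/

section Algorithm

variable {Ω : Type*} {K : ℕ}

/-- `N_{n,k}`, the number of pulls of the arm `k` before time `n`. -/
def pulls (I : ℕ → Ω → Fin K) (n : ℕ) (k : Fin K) (ω : Ω) : ℕ :=
  ((Finset.Ico 1 n).filter (fun t => I t ω = k)).card

/-- `μ_{n,k}`, the empirical mean of the arm `k` before time `n`. -/
noncomputable def empMean (I : ℕ → Ω → Fin K) (X : ℕ → Ω → ℝ) (n : ℕ) (k : Fin K) (ω : Ω) : ℝ :=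
  (∑ t ∈ (Finset.Ico 1 n).filter (fun t => I t ω = k), X t ω) / (pulls I n k ω : ℝ)

/-- The empirical transportation cost with slack `ε₀` of the arm `k` against the leader `b`. -/
noncomputable def transportCost (ε₀ : ℝ) (I : ℕ → Ω → Fin K) (X : ℕ → Ω → ℝ) (n : ℕ)
    (b k : Fin K) (ω : Ω) : ℝ :=
  (empMean I X n b ω - empMean I X n k ω + ε₀) /
    Real.sqrt (1 / (pulls I n b ω : ℝ) + 1 / (pulls I n k ω : ℝ))

/-- `T_n(i,j)`, the number of rounds before time `n`, after the initialization, with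
leader `i` and challenger `j`. -/
def pairCount (B C : ℕ → Ω → Fin K) (n : ℕ) (i j : Fin K) (ω : Ω) : ℕ :=
  ((Finset.Ioo K n).filter (fun t => B t ω = i ∧ C t ω = j)).card

/-- `N^i_{n,j}`, the number of those rounds in which the challenger `j` was pulled. -/
def challengerPulls (B C I : ℕ → Ω → Fin K) (n : ℕ) (i j : Fin K) (ω : Ω) : ℕ :=
  ((Finset.Ioo K n).filter (fun t => (B t ω = i ∧ C t ω = j) ∧ I t ω = j)).card

/-- The history `F_n` before time `n`, generated by `(I_t, X_t)` for `1 ≤ t < n`. -/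
def history [mΩ : MeasurableSpace Ω] (I : ℕ → Ω → Fin K) (X : ℕ → Ω → ℝ)
    (hI : ∀ n, Measurable (I n)) (hX : ∀ n, Measurable (X n)) : Filtration ℕ mΩ where
  seq n := ⨆ t ∈ Finset.Ico 1 n,
    MeasurableSpace.comap (fun ω => (I t ω, X t ω)) inferInstance
  mono' := fun _ _ h => biSup_mono (fun _ ht =>
    Finset.mem_Ico.2 ⟨(Finset.mem_Ico.1 ht).1, (Finset.mem_Ico.1 ht).2.trans_le h⟩)
  le' := fun _ => iSup₂_le (fun t _ => ((hI t).prodMk (hX t)).comap_le)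

/-- The processes `ihat` (recommendation, which is also the leader), `C` (challenger), `I`
(pulled arm) and `X` (observed reward) are a run on the probability space `(Ω, P)` of the
algorithm EB-TC with slack `ε₀` and fixed proportion `β` on the bandit instance `ν`.
Ties in the two optimizations are broken arbitrarily. -/
structure IsEBTCRun [mΩ : MeasurableSpace Ω] (P : Measure Ω) (ν : Fin K → Measure ℝ) (ε₀ β : ℝ)
    (ihat C I : ℕ → Ω → Fin K) (X : ℕ → Ω → ℝ) : Prop where
  measurable_ihat : ∀ n, Measurable (ihat n)
  measurable_challenger : ∀ n, Measurable (C n)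
  measurable_arm : ∀ n, Measurable (I n)
  measurable_reward : ∀ n, Measurable (X n)
  /-- Given the history before time `n` and the pulled arm `I_n`, the reward has law `ν_{I_n}`. -/
  reward_law : ∀ n, 1 ≤ n → ∀ s : Set ℝ, MeasurableSet s →
    P⟦X n ⁻¹' s | (history I X measurable_arm measurable_reward n ⊔
        MeasurableSpace.comap (I n) inferInstance : MeasurableSpace Ω)⟧
      =ᵐ[P] fun ω => (ν (I n ω)).real s
  /-- During the first `K` rounds each arm is pulled once. -/
  init : ∀ ω k, ∃ t ∈ Finset.Icc 1 K, I t ω = k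
  /-- The recommendation is an empirical best arm. -/
  ihat_max : ∀ ω n, K < n → ∀ k, empMean I X n k ω ≤ empMean I X n (ihat n ω) ω
  challenger_ne : ∀ ω n, K < n → C n ω ≠ ihat n ω
  /-- The challenger minimizes the transportation cost. -/
  challenger_min : ∀ ω n, K < n → ∀ k, k ≠ ihat n ω →
    transportCost ε₀ I X n (ihat n ω) (C n ω) ω ≤ transportCost ε₀ I X n (ihat n ω) k ω
  /-- Tracking, with one procedure for each pair of leader and challenger. -/
  pull_challenger : ∀ ω n, K < n →
    (challengerPulls ihat C I n (ihat n ω) (C n ω) ω : ℝ) ≤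
      (1 - β) * (pairCount ihat C (n + 1) (ihat n ω) (C n ω) ω : ℝ) →
    I n ω = C n ω
  pull_leader : ∀ ω n, K < n →
    (1 - β) * (pairCount ihat C (n + 1) (ihat n ω) (C n ω) ω : ℝ) <
      (challengerPulls ihat C I n (ihat n ω) (C n ω) ω : ℝ) →
    I n ω = ihat n ω

/-- The `(ε, δ)`-unverifiable sample complexity: the least expectation (an infimum) of a stopping
time `τ` of the filtration `F` such that, with probability at least `1 - δ`, all recommendations
from `τ` on are `ε`-good. As recommendations start after time `K`, `τ > K` is required. -/
noncomputable def unverifiableSampleComplexity [mΩ : MeasurableSpace Ω] (P : Measure Ω)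
    (F : Filtration ℕ mΩ) (μ : Fin K → ℝ) (ihat : ℕ → Ω → Fin K) (ε δ : ℝ) : ℝ≥0∞ :=
  ⨅ τ ∈ {τ : Ω → ℕ∞ | IsStoppingTime F τ ∧ (∀ ω, (K : ℕ∞) < τ ω) ∧
      ENNReal.ofReal (1 - δ) ≤ P {ω | ∀ n : ℕ, τ ω ≤ (n : ℕ∞) → ihat n ω ∈ goodArms μ ε}},
    ∫⁻ ω, ((τ ω : ℕ∞) : ℝ≥0∞) ∂P

end Algorithm

/-!
The proof compares two ways of counting rounds on a concentration event.

*Concentration.* Supermartingales built from exponential weights show that, at a fixed pair of pull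
counts `a`, `b`, the difference of the errors of two empirical means exceeds
`√(2 f (1/a + 1/b))` with probability at most `e^{-f}`. A union bound over the counts below a fixed
time `T` costs a factor `T²`, so `f = log (1/δ) + 2 log T + log (K (K + 1) / 2)` makes the event
likely. The same event controls forever the arms which have been pulled often enough.

*One round.* If leader and challenger have both been pulled more than `4 f c²` times, for the
appropriate constants `c`, then the minimality of the transportation cost of the challenger shows
that the leader has a small gap, and that the arms with a large gap have been pulled often enough to
look bad from then on.

*Counting.* The tracking rule gives at least half of the rounds of a pair to its challenger, so an
arm which is repeatedly leader or challenger is soon pulled more than `4 f c²` times. If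
`T > 8 H_i f + 5 K² / 2`, some round before `T` thus has well sampled leader and challenger, and
some arm with a small gap is pulled often. After `T` this arm beats the bad ones empirically, so no
bad arm is recommended. The Lambert function solves the implicit condition on `T`.
-/

/-! ### Gaps -/

section Gaps

variable {K : ℕ} {μ : Fin K → ℝ}

theorem le_maxMean (μ : Fin K → ℝ) (k : Fin K) : μ k ≤ maxMean μ :=
  le_ciSup (Set.finite_range μ).bddAbove k

theorem exists_eq_maxMean (hK : 0 < K) (μ : Fin K → ℝ) : ∃ k, μ k = maxMean μ := by
  have : Nonempty (Fin K) := ⟨⟨0, hK⟩⟩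
  exact exists_eq_ciSup_of_finite

theorem exists_gap_eq_sortedGap (μ : Fin K → ℝ) (k : Fin K) :
    ∃ m ∈ Set.Icc 1 (numClasses μ), maxMean μ - μ k = sortedGap μ m := by
  have hrange : maxMean μ - μ k ∈ Set.range ((gapSet μ).orderEmbOfFin (card_gapSet μ)) := by
    rw [Finset.range_orderEmbOfFin]
    simp [gapSet]
  obtain ⟨⟨m, hm⟩, hgap⟩ := hrange
  refine ⟨m + 1, ⟨by omega, hm⟩, ?_⟩
  rw [sortedGap, dif_pos (by simpa using hm)]
  exact hgap.symm

theorem exists_sortedGap_eq_gap {m : ℕ} (hm : m ∈ Set.Icc 1 (numClasses μ)) :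
    ∃ k, sortedGap μ m = maxMean μ - μ k := by
  rw [Set.mem_Icc] at hm
  rw [sortedGap, dif_pos (by omega)]
  obtain ⟨k, -, hk⟩ :=
    Finset.mem_image.1 ((gapSet μ).orderEmbOfFin_mem (card_gapSet μ) ⟨m - 1, by omega⟩)
  exact ⟨k, hk.symm⟩

theorem strictMonoOn_sortedGap (μ : Fin K → ℝ) :
    StrictMonoOn (sortedGap μ) (Set.Icc 1 (numClasses μ)) := by
  intro i hi j hj hij
  rw [Set.mem_Icc] at hi hj
  rw [sortedGap, sortedGap, dif_pos (by omega), dif_pos (by omega), OrderEmbedding.lt_iff_lt,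
    Fin.mk_lt_mk]
  omega

theorem sortedGap_nonneg {m : ℕ} (hm : m ∈ Set.Icc 1 (numClasses μ)) : 0 ≤ sortedGap μ m := by
  obtain ⟨k, hk⟩ := exists_sortedGap_eq_gap hm
  rw [hk]
  exact sub_nonneg.2 (le_maxMean μ k)

theorem sortedGap_one (μ : Fin K → ℝ) : sortedGap μ 1 = 0 := by
  rcases Nat.eq_zero_or_pos K with rfl | hK
  · simp [sortedGap, numClasses]
  · obtain ⟨k, hk⟩ := exists_eq_maxMean hK μ
    obtain ⟨m, hm, hgap⟩ := exists_gap_eq_sortedGap μ k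
    have hone : 1 ∈ Set.Icc 1 (numClasses μ) := ⟨le_rfl, hm.1.trans hm.2⟩
    have hle := (strictMonoOn_sortedGap μ).monotoneOn hone hm hm.1
    linarith [sortedGap_nonneg hone]

theorem sortedGap_pos {m : ℕ} (hm : 1 < m) (hmn : m ≤ numClasses μ) : 0 < sortedGap μ m :=
  (sortedGap_one μ).symm.trans_lt
    (strictMonoOn_sortedGap μ ⟨le_rfl, hm.le.trans hmn⟩ ⟨hm.le, hmn⟩ hm)

/-- The index `i` of the class `C_μ(i)` of an arm. -/
noncomputable def gapIndex (μ : Fin K → ℝ) (k : Fin K) : ℕ :=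
  (exists_gap_eq_sortedGap μ k).choose

theorem gapIndex_mem (μ : Fin K → ℝ) (k : Fin K) : gapIndex μ k ∈ Set.Icc 1 (numClasses μ) :=
  (exists_gap_eq_sortedGap μ k).choose_spec.1

theorem gap_eq_sortedGap (μ : Fin K → ℝ) (k : Fin K) :
    maxMean μ - μ k = sortedGap μ (gapIndex μ k) :=
  (exists_gap_eq_sortedGap μ k).choose_spec.2

theorem gapIndex_eq_iff {k : Fin K} {m : ℕ} (hm : m ∈ Set.Icc 1 (numClasses μ)) :
    gapIndex μ k = m ↔ maxMean μ - μ k = sortedGap μ m := by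
  rw [gap_eq_sortedGap, (strictMonoOn_sortedGap μ).injOn.eq_iff (gapIndex_mem μ k) hm]

theorem gapIndex_eq_one_iff {k : Fin K} : gapIndex μ k = 1 ↔ μ k = maxMean μ := by
  have hk := gapIndex_mem μ k
  rw [gapIndex_eq_iff ⟨le_rfl, hk.1.trans hk.2⟩, sortedGap_one, sub_eq_zero, eq_comm]

theorem gap_le_sortedGap_iff {k : Fin K} {m : ℕ} (hm : m ∈ Set.Icc 1 (numClasses μ)) :
    maxMean μ - μ k ≤ sortedGap μ m ↔ gapIndex μ k ≤ m := by
  rw [gap_eq_sortedGap, (strictMonoOn_sortedGap μ).le_iff_le (gapIndex_mem μ k) hm]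

theorem sortedGap_le_gap_iff {k : Fin K} {m : ℕ} (hm : m ∈ Set.Icc 1 (numClasses μ)) :
    sortedGap μ m ≤ maxMean μ - μ k ↔ m ≤ gapIndex μ k := by
  rw [gap_eq_sortedGap, (strictMonoOn_sortedGap μ).le_iff_le hm (gapIndex_mem μ k)]

theorem card_filter_gapIndex_eq {m : ℕ} (hm : m ∈ Set.Icc 1 (numClasses μ)) :
    (Finset.univ.filter (fun k => gapIndex μ k = m)).card = classSize μ m := by
  rw [classSize]
  congr 1
  exact Finset.filter_congr fun k _ => gapIndex_eq_iff hm

theorem card_bestArms (μ : Fin K → ℝ) : (bestArms μ).card = classSize μ 1 := by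
  rw [bestArms, classSize, sortedGap_one]
  congr 1
  exact Finset.filter_congr fun k _ => by rw [sub_eq_zero, eq_comm]

theorem sum_comp_gapIndex (μ : Fin K → ℝ) (F : ℕ → ℝ) :
    ∑ k, F (gapIndex μ k) = ∑ m ∈ Finset.Icc 1 (numClasses μ), (classSize μ m : ℝ) * F m := by
  rw [← Finset.sum_fiberwise_of_maps_to (g := gapIndex μ)
    fun k _ => Finset.mem_Icc.2 (gapIndex_mem μ k)]
  refine Finset.sum_congr rfl fun m hm => ?_
  rw [← card_filter_gapIndex_eq (Finset.mem_Icc.1 hm), ← nsmul_eq_mul, ← Finset.sum_const]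
  exact Finset.sum_congr rfl fun k hk => by rw [(Finset.mem_filter.1 hk).2]

theorem card_filter_gapIndex_le {j : ℕ} (hj : j ≤ numClasses μ) :
    ((Finset.univ.filter (fun k => gapIndex μ k ≤ j)).card : ℝ)
      = ∑ m ∈ Finset.Icc 1 j, (classSize μ m : ℝ) := by
  have hsum := sum_comp_gapIndex μ (fun m => if m ≤ j then 1 else 0)
  simp only [mul_ite, mul_one, mul_zero, Finset.sum_ite, Finset.sum_const_zero, add_zero,
    Finset.sum_const, nsmul_eq_mul] at hsum
  rw [hsum]
  congr 1
  ext m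
  simp only [Finset.mem_filter, Finset.mem_Icc]
  omega

theorem classIndex_mem_classIndexSet {ε : ℝ} (hi : classIndex μ ε < numClasses μ) :
    classIndex μ ε ∈ classIndexSet μ ε := by
  have hne : (classIndexSet μ ε).Nonempty := by
    by_contra hempty
    rw [classIndex, if_neg hempty] at hi
    exact lt_irrefl _ hi
  rw [classIndex, if_pos hne]
  exact Nat.sInf_mem hne

theorem one_le_classIndex (hK : 0 < K) (μ : Fin K → ℝ) (ε : ℝ) : 1 ≤ classIndex μ ε := by
  rcases lt_or_ge (classIndex μ ε) (numClasses μ) with hi | hi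
  · exact (classIndex_mem_classIndexSet hi).1
  · have hk := gapIndex_mem μ ⟨0, hK⟩
    exact (hk.1.trans hk.2).trans hi

theorem mem_goodArms_of_gapIndex_le_classIndex {ε : ℝ} (hi : classIndex μ ε < numClasses μ)
    {k : Fin K} (hk : gapIndex μ k ≤ classIndex μ ε) : k ∈ goodArms μ ε := by
  have hmem := classIndex_mem_classIndexSet hi
  have hgap := (gap_le_sortedGap_iff ⟨hmem.1, hi.le⟩).2 hk
  exact sub_le_comm.1 (hgap.trans hmem.2.2.1)

theorem sortedGap_le_of_numClasses_le_classIndex {ε : ℝ} (hε : 0 ≤ ε)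
    (hi : numClasses μ ≤ classIndex μ ε) {m : ℕ} (hm : 1 ≤ m) (hmn : m ≤ numClasses μ) :
    sortedGap μ m ≤ ε := by
  induction m, hm using Nat.le_induction with
  | base => rwa [sortedGap_one]
  | succ m hm ih =>
    by_contra! hlt
    have hmem : m ∈ classIndexSet μ ε := ⟨hm, hmn, ih (by omega), hlt⟩
    rw [classIndex, if_pos ⟨m, hmem⟩] at hi
    exact absurd (hi.trans (Nat.sInf_le hmem)) (not_le.2 hmn)

theorem mem_goodArms_of_numClasses_le_classIndex {ε : ℝ} (hε : 0 ≤ ε)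
    (hi : numClasses μ ≤ classIndex μ ε) (k : Fin K) : k ∈ goodArms μ ε := by
  have hk := gapIndex_mem μ k
  have hgap := sortedGap_le_of_numClasses_le_classIndex hε hi hk.1 hk.2
  rw [← gap_eq_sortedGap] at hgap
  exact sub_le_comm.1 hgap

/-! ### Complexities as sums over the arms -/

/-- The factor of an arm of class `m` in `hBar μ ε₀ i j`, before squaring. -/
noncomputable def barTerm (μ : Fin K → ℝ) (ε₀ : ℝ) (i j m : ℕ) : ℝ :=
  if m = 1 then max (Real.sqrt 2 * (sortedGap μ (j + 1))⁻¹) (cTwo μ ε₀ (i + 1) j)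
  else if m ≤ j ∨ i < m then max (cOne μ ε₀ (j + 1)) (cTwo μ ε₀ (i + 1) j)
  else max (max (cOne μ ε₀ (j + 1)) (cTwo μ ε₀ (i + 1) j)) (Real.sqrt 2 * (sortedGap μ m)⁻¹)

/-- The factor of an arm of class `m` in `hTilde μ ε₀ i j`, before squaring, without the summand
`2 / (Δ_{i+1} - Δ_j) ^ 2` common to the classes up to `j`. -/
noncomputable def tildeTerm (μ : Fin K → ℝ) (ε₀ : ℝ) (j m : ℕ) : ℝ :=
  if m = 1 then Real.sqrt 2 * (sortedGap μ (j + 1))⁻¹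
  else if m ≤ j then max (cOne μ ε₀ (j + 1)) ε₀⁻¹
  else max (max (cOne μ ε₀ (j + 1)) ε₀⁻¹) (Real.sqrt 2 * (sortedGap μ m)⁻¹)

theorem sum_Icc_one_split {M : Type*} [AddCommMonoid M] (F : ℕ → M) {i j n : ℕ} (hj : 1 ≤ j)
    (hji : j ≤ i) (hin : i ≤ n) :
    ∑ m ∈ Finset.Icc 1 n, F m = F 1 + ∑ m ∈ Finset.Icc 2 j, F m
      + ∑ m ∈ Finset.Icc (j + 1) i, F m + ∑ m ∈ Finset.Icc (i + 1) n, F m := by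
  rw [show (2 : ℕ) = 1 + 1 from rfl, show Finset.Icc 1 n = Finset.Icc (0 + 1) n from rfl]
  simp only [Finset.Icc_add_one_left_eq_Ioc]
  rw [← Finset.sum_Ioc_consecutive F (Nat.zero_le i) hin,
    ← Finset.sum_Ioc_consecutive F (Nat.zero_le j) hji,
    ← Finset.sum_Ioc_consecutive F (Nat.zero_le 1) hj]
  simp

theorem sum_classSize_mul_sq_eq {F : ℕ → ℝ} {s : Finset ℕ} {c : ℝ} (hF : ∀ m ∈ s, F m = c) :
    ∑ m ∈ s, (classSize μ m : ℝ) * F m ^ 2 = c ^ 2 * ∑ m ∈ s, (classSize μ m : ℝ) := by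
  rw [Finset.mul_sum]
  exact Finset.sum_congr rfl fun m hm => by rw [hF m hm, mul_comm]

theorem sum_barTerm_sq (μ : Fin K → ℝ) (ε₀ : ℝ) {i j : ℕ} (hj : 1 ≤ j) (hji : j ≤ i)
    (hi : i ≤ numClasses μ) :
    ∑ k, barTerm μ ε₀ i j (gapIndex μ k) ^ 2 = hBar μ ε₀ i j := by
  have hlow : ∀ m ∈ Finset.Icc 2 j,
      barTerm μ ε₀ i j m = max (cOne μ ε₀ (j + 1)) (cTwo μ ε₀ (i + 1) j) := fun m hm => by
    rw [Finset.mem_Icc] at hm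
    rw [barTerm, if_neg (by omega), if_pos (by omega)]
  have hhigh : ∀ m ∈ Finset.Icc (i + 1) (numClasses μ),
      barTerm μ ε₀ i j m = max (cOne μ ε₀ (j + 1)) (cTwo μ ε₀ (i + 1) j) := fun m hm => by
    rw [Finset.mem_Icc] at hm
    rw [barTerm, if_neg (by omega), if_pos (by omega)]
  have hmid : ∑ m ∈ Finset.Icc (j + 1) i, (classSize μ m : ℝ) * barTerm μ ε₀ i j m ^ 2
      = ∑ m ∈ Finset.Icc (j + 1) i, (classSize μ m : ℝ) *
        (max (max (cOne μ ε₀ (j + 1)) (cTwo μ ε₀ (i + 1) j))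
          (Real.sqrt 2 * (sortedGap μ m)⁻¹)) ^ 2 := by
    refine Finset.sum_congr rfl fun m hm => ?_
    rw [Finset.mem_Icc] at hm
    rw [barTerm, if_neg (by omega), if_neg (by omega)]
  rw [sum_comp_gapIndex μ (fun m => barTerm μ ε₀ i j m ^ 2), sum_Icc_one_split _ hj hji hi, hBar,
    card_bestArms, sum_classSize_mul_sq_eq hlow, sum_classSize_mul_sq_eq hhigh, hmid, barTerm,
    if_pos rfl]
  ring

theorem sum_tildeTerm_sq_add (μ : Fin K → ℝ) (ε₀ : ℝ) (i : ℕ) {j : ℕ} (hj : 1 ≤ j)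
    (hjn : j ≤ numClasses μ) :
    ∑ k, tildeTerm μ ε₀ j (gapIndex μ k) ^ 2
      + (Finset.univ.filter (fun k => gapIndex μ k ≤ j)).card *
        (2 / (sortedGap μ (i + 1) - sortedGap μ j) ^ 2) = hTilde μ ε₀ i j := by
  have hlow : ∀ m ∈ Finset.Icc 2 j,
      tildeTerm μ ε₀ j m = max (cOne μ ε₀ (j + 1)) ε₀⁻¹ := fun m hm => by
    rw [Finset.mem_Icc] at hm
    rw [tildeTerm, if_neg (by omega), if_pos (by omega)]
  have hhigh : ∑ m ∈ Finset.Icc (j + 1) (numClasses μ),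
        (classSize μ m : ℝ) * tildeTerm μ ε₀ j m ^ 2
      = ∑ m ∈ Finset.Icc (j + 1) (numClasses μ), (classSize μ m : ℝ) *
        (max (max (cOne μ ε₀ (j + 1)) ε₀⁻¹) (Real.sqrt 2 * (sortedGap μ m)⁻¹)) ^ 2 := by
    refine Finset.sum_congr rfl fun m hm => ?_
    rw [Finset.mem_Icc] at hm
    rw [tildeTerm, if_neg (by omega), if_neg (by omega)]
  rw [sum_comp_gapIndex μ (fun m => tildeTerm μ ε₀ j m ^ 2), sum_Icc_one_split _ hj le_rfl hjn,
    hTilde, card_bestArms, card_filter_gapIndex_le hjn, sum_classSize_mul_sq_eq hlow, hhigh,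
    tildeTerm, if_pos rfl, mul_pow, Real.sq_sqrt zero_le_two,
    Finset.Icc_eq_empty (by omega : ¬ j + 1 ≤ j), Finset.sum_empty, inv_pow]
  ring

theorem max_inv_le_max_cOne {ε₀ c : ℝ} (m : ℕ) (hc : ε₀⁻¹ ≤ c) :
    max (sortedGap μ m)⁻¹ ε₀⁻¹ ≤ max (cOne μ ε₀ m) c := by
  refine max_le ?_ (hc.trans (le_max_right _ _))
  rcases le_total (sortedGap μ m)⁻¹ ε₀⁻¹ with hle | hle
  · exact (hle.trans hc).trans (le_max_right _ _)
  · exact le_trans (by rw [cOne]; linarith) (le_max_left _ _)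

theorem inv_sortedGap_le_sqrt_two_mul {m : ℕ} (hm : m ∈ Set.Icc 1 (numClasses μ)) :
    (sortedGap μ m)⁻¹ ≤ Real.sqrt 2 * (sortedGap μ m)⁻¹ :=
  le_mul_of_one_le_left (inv_nonneg.2 (sortedGap_nonneg hm)) (Real.one_le_sqrt.2 one_le_two)

theorem inv_le_cTwo {ε₀ : ℝ} (hε₀ : 0 < ε₀) {i j : ℕ} (hj : 1 ≤ j) (hji : j ≤ i)
    (hi : i < numClasses μ) : ε₀⁻¹ ≤ cTwo μ ε₀ (i + 1) j := by
  have hgap : 0 ≤ sortedGap μ j := sortedGap_nonneg ⟨hj, by omega⟩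
  have hsep : 0 < sortedGap μ (i + 1) - sortedGap μ j :=
    sub_pos.2 (strictMonoOn_sortedGap μ ⟨hj, by omega⟩ ⟨by omega, hi⟩ (by omega))
  have hinv : 0 < ε₀⁻¹ := inv_pos.2 hε₀
  have hfirst : 0 ≤ 2 * ((sortedGap μ j / ε₀ + 1) / (sortedGap μ (i + 1) - sortedGap μ j)) := by
    positivity
  rw [cTwo]
  linarith

theorem cTwo_le_barTerm (μ : Fin K → ℝ) (ε₀ : ℝ) (i j m : ℕ) :
    cTwo μ ε₀ (i + 1) j ≤ barTerm μ ε₀ i j m := by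
  rw [barTerm]
  split_ifs
  · exact le_max_right _ _
  · exact le_max_right _ _
  · exact (le_max_right _ _).trans (le_max_left _ _)

theorem inv_le_barTerm_one (ε₀ : ℝ) (i : ℕ) {j : ℕ} (hj : j < numClasses μ) :
    (sortedGap μ (j + 1))⁻¹ ≤ barTerm μ ε₀ i j 1 := by
  rw [barTerm, if_pos rfl]
  exact (inv_sortedGap_le_sqrt_two_mul ⟨by omega, hj⟩).trans (le_max_left _ _)

theorem max_inv_le_barTerm {ε₀ : ℝ} (hε₀ : 0 < ε₀) {i j m : ℕ} (hj : 1 ≤ j) (hji : j ≤ i)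
    (hi : i < numClasses μ) (hm : m ≠ 1) :
    max (sortedGap μ (j + 1))⁻¹ ε₀⁻¹ ≤ barTerm μ ε₀ i j m := by
  have hle := max_inv_le_max_cOne (μ := μ) (j + 1) (inv_le_cTwo (μ := μ) hε₀ hj hji hi)
  rw [barTerm, if_neg hm]
  split_ifs
  · exact hle
  · exact hle.trans (le_max_left _ _)

theorem inv_le_tildeTerm_one (ε₀ : ℝ) {j : ℕ} (hj : j < numClasses μ) :
    (sortedGap μ (j + 1))⁻¹ ≤ tildeTerm μ ε₀ j 1 := by
  rw [tildeTerm, if_pos rfl]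
  exact inv_sortedGap_le_sqrt_two_mul ⟨by omega, hj⟩

theorem max_inv_le_tildeTerm (μ : Fin K → ℝ) (ε₀ : ℝ) (j : ℕ) {m : ℕ} (hm : m ≠ 1) :
    max (sortedGap μ (j + 1))⁻¹ ε₀⁻¹ ≤ tildeTerm μ ε₀ j m := by
  have hle := max_inv_le_max_cOne (μ := μ) (j + 1) (le_refl ε₀⁻¹)
  rw [tildeTerm, if_neg hm]
  split_ifs
  · exact hle
  · exact hle.trans (le_max_left _ _)

theorem hBar_pos {ε₀ : ℝ} (hε₀ : 0 < ε₀) {i j : ℕ} (hj : 1 ≤ j) (hji : j ≤ i)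
    (hi : i < numClasses μ) : 0 < hBar μ ε₀ i j := by
  obtain ⟨k, -⟩ := exists_sortedGap_eq_gap (μ := μ) (m := j) ⟨hj, by omega⟩
  rw [← sum_barTerm_sq μ ε₀ hj hji hi.le]
  exact Finset.sum_pos (fun k _ => pow_pos ((inv_pos.2 hε₀).trans_le
    ((inv_le_cTwo hε₀ hj hji hi).trans (cTwo_le_barTerm μ ε₀ i j _))) 2) ⟨k, Finset.mem_univ k⟩

theorem two_div_sq_le_hTilde (ε₀ : ℝ) (i : ℕ) {j : ℕ} (hj : 1 ≤ j) (hjn : j ≤ numClasses μ) :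
    2 / (sortedGap μ (i + 1) - sortedGap μ j) ^ 2 ≤ hTilde μ ε₀ i j := by
  obtain ⟨k, hk⟩ := exists_sortedGap_eq_gap (μ := μ) ⟨hj, hjn⟩
  have hcard : (1 : ℝ) ≤ (Finset.univ.filter (fun k => gapIndex μ k ≤ j)).card := by
    exact_mod_cast Finset.card_pos.2
      ⟨k, by simp [(gapIndex_eq_iff (⟨hj, hjn⟩ : j ∈ Set.Icc 1 _)).2 hk.symm]⟩
  rw [← sum_tildeTerm_sq_add μ ε₀ i hj hjn]
  exact (le_mul_of_one_le_left (by positivity) hcard).trans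
    (le_add_of_nonneg_left (Finset.sum_nonneg fun k _ => sq_nonneg _))

theorem exists_complexityH_eq (μ : Fin K → ℝ) (ε₀ : ℝ) {i : ℕ} (hi : 1 ≤ i) :
    ∃ j, 1 ≤ j ∧ j ≤ i ∧ complexityH μ ε₀ i = max (hBar μ ε₀ i j) (hTilde μ ε₀ i j) := by
  have : Nonempty (Finset.Icc 1 i) := ⟨⟨1, Finset.mem_Icc.2 ⟨le_rfl, hi⟩⟩⟩
  obtain ⟨⟨j, hj⟩, hmin⟩ := exists_eq_ciInf_of_finite
    (f := fun j : Finset.Icc 1 i => max (hBar μ ε₀ i j) (hTilde μ ε₀ i j))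
  rw [Finset.mem_Icc] at hj
  exact ⟨j, hj.1, hj.2, hmin.symm⟩

theorem complexityH_pos {ε₀ : ℝ} (hε₀ : 0 < ε₀) {i : ℕ} (hi : 1 ≤ i) (hin : i < numClasses μ) :
    0 < complexityH μ ε₀ i := by
  obtain ⟨j, hj, hji, hH⟩ := exists_complexityH_eq μ ε₀ hi
  rw [hH]
  exact lt_max_of_lt_left (hBar_pos hε₀ hj hji hin)

end Gaps

/-! ### Exponential weights -/

section Pulls

variable {Ω : Type*} {K : ℕ}

theorem pulls_succ (I : ℕ → Ω → Fin K) {n : ℕ} (hn : 1 ≤ n) (k : Fin K) (ω : Ω) :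
    pulls I (n + 1) k ω = pulls I n k ω + if I n ω = k then 1 else 0 := by
  rw [pulls, pulls, Finset.card_filter, Finset.card_filter, Finset.sum_Ico_succ_top hn]

theorem pulls_mono (I : ℕ → Ω → Fin K) (k : Fin K) (ω : Ω) : Monotone fun n => pulls I n k ω :=
  fun _ _ hn => Finset.card_le_card
    (Finset.filter_subset_filter _ (Finset.Ico_subset_Ico_right hn))

theorem pulls_lt_pulls_iff {I : ℕ → Ω → Fin K} {s t : ℕ} {k : Fin K} {ω : Ω} (hs : 1 ≤ s)
    (hI : I s ω = k) : pulls I s k ω < pulls I t k ω ↔ s < t := by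
  refine ⟨fun hlt => lt_of_not_ge fun hts => (pulls_mono I k ω hts).not_gt hlt, fun hst => ?_⟩
  have hsucc : pulls I (s + 1) k ω = pulls I s k ω + 1 := by rw [pulls_succ I hs, if_pos hI]
  have hle : pulls I (s + 1) k ω ≤ pulls I t k ω := pulls_mono I k ω hst
  omega

theorem sum_ite_pulls_lt_pulls {M : Type*} [AddCommMonoid M] (I : ℕ → Ω → Fin K) (φ : ℕ → M)
    (ω : Ω) (k : Fin K) {t T : ℕ} (ht : t ≤ T) :
    ∑ s ∈ Finset.Ico 1 T, (if I s ω = k ∧ pulls I s k ω < pulls I t k ω then φ s else 0)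
      = ∑ s ∈ (Finset.Ico 1 t).filter (fun s => I s ω = k), φ s := by
  rw [← Finset.sum_filter]
  congr 1
  ext s
  simp only [Finset.mem_filter, Finset.mem_Ico]
  constructor
  · rintro ⟨⟨hs, _⟩, hI, hlt⟩
    exact ⟨⟨hs, (pulls_lt_pulls_iff hs hI).1 hlt⟩, hI⟩
  · rintro ⟨⟨hs, hst⟩, hI⟩
    exact ⟨⟨hs, hst.trans_le ht⟩, hI, (pulls_lt_pulls_iff hs hI).2 hst⟩

theorem sum_mul_reward_sub_sub_eq (I : ℕ → Ω → Fin K) (X : ℕ → Ω → ℝ) (ω : Ω) (t : ℕ) (k : Fin K)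
    (m l c : ℝ) :
    ∑ s ∈ (Finset.Ico 1 t).filter (fun s => I s ω = k), (l * (X s ω - m) - c)
      = pulls I t k ω * (l * (empMean I X t k ω - m) - c) := by
  have hcard : ((Finset.Ico 1 t).filter (fun s => I s ω = k)).card = pulls I t k ω := rfl
  rcases Nat.eq_zero_or_pos (pulls I t k ω) with hzero | hpos
  · rw [Finset.card_eq_zero.1 (hcard.trans hzero), hzero]
    simp
  · have hne : (pulls I t k ω : ℝ) ≠ 0 := by positivity
    rw [Finset.sum_sub_distrib, ← Finset.mul_sum, Finset.sum_sub_distrib, Finset.sum_const,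
      Finset.sum_const, hcard, empMean, nsmul_eq_mul, nsmul_eq_mul]
    field_simp

theorem measurable_pulls {m : MeasurableSpace Ω} {I : ℕ → Ω → Fin K} {n : ℕ}
    (hI : ∀ t ∈ Finset.Ico 1 n, Measurable[m] (I t)) (k : Fin K) :
    Measurable[m] (pulls I n k) := by
  have hsum : pulls I n k = fun ω => ∑ t ∈ Finset.Ico 1 n, if I t ω = k then 1 else 0 := by
    ext ω
    rw [pulls, Finset.card_filter]
  rw [hsum]
  exact Finset.measurable_sum _ fun t ht =>
    Measurable.ite (hI t ht (measurableSet_singleton k)) measurable_const measurable_const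

/-- The process `n ↦ ∑_{t < n} (L_t (X_t - μ_{I_t}) - L_t² / 2)`, the logarithm of the exponential
weight with parameters `L`. -/
noncomputable def logWeight (μ : Fin K → ℝ) (L : ℕ → Ω → ℝ) (I : ℕ → Ω → Fin K) (X : ℕ → Ω → ℝ)
    (n : ℕ) (ω : Ω) : ℝ :=
  ∑ t ∈ Finset.Ico 1 n, (L t ω * (X t ω - μ (I t ω)) - L t ω ^ 2 / 2)

/-- The parameters that isolate the first `a k` rewards of each arm `k`, weighted with `l k`, in the
exponential weight. -/
noncomputable def firstPullsWeight (a : Fin K → ℕ) (l : Fin K → ℝ) (I : ℕ → Ω → Fin K) (t : ℕ)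
    (ω : Ω) : ℝ :=
  if pulls I t (I t ω) ω < a (I t ω) then l (I t ω) else 0

theorem logWeight_firstPullsWeight (μ : Fin K → ℝ) (a : Fin K → ℕ) (l : Fin K → ℝ)
    (I : ℕ → Ω → Fin K) (X : ℕ → Ω → ℝ) {t T : ℕ} (ht : t ≤ T) {ω : Ω}
    (ha : ∀ k, a k = 0 ∨ pulls I t k ω = a k) :
    logWeight μ (firstPullsWeight a l I) I X T ω
      = ∑ k, a k * (l k * (empMean I X t k ω - μ k) - l k ^ 2 / 2) := by
  have hterm : logWeight μ (firstPullsWeight a l I) I X T ω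
      = ∑ s ∈ Finset.Ico 1 T, ∑ k, (if I s ω = k ∧ pulls I s k ω < a k then
          l k * (X s ω - μ k) - l k ^ 2 / 2 else 0) := by
    refine Finset.sum_congr rfl fun s _ => ?_
    simp only [ite_and, Finset.sum_ite_eq, Finset.mem_univ, if_true, firstPullsWeight]
    split_ifs <;> simp
  rw [hterm, Finset.sum_comm]
  refine Finset.sum_congr rfl fun k _ => ?_
  rcases ha k with hzero | hpulls
  · simp [hzero]
  · rw [← hpulls, sum_ite_pulls_lt_pulls I (fun s => l k * (X s ω - μ k) - l k ^ 2 / 2) ω k ht,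
      sum_mul_reward_sub_sub_eq]

end Pulls

section History

variable {Ω : Type*} {K : ℕ} [mΩ : MeasurableSpace Ω] {I : ℕ → Ω → Fin K} {X : ℕ → Ω → ℝ}

theorem comap_le_history (hI : ∀ n, Measurable (I n)) (hX : ∀ n, Measurable (X n)) {n t : ℕ}
    (ht : t ∈ Finset.Ico 1 n) :
    MeasurableSpace.comap (fun ω => (I t ω, X t ω)) inferInstance ≤ history I X hI hX n :=
  le_iSup₂_of_le (f := fun t (_ : t ∈ Finset.Ico 1 n) =>
    MeasurableSpace.comap (fun ω => (I t ω, X t ω)) inferInstance) t ht le_rfl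

theorem measurable_arm_history (hI : ∀ n, Measurable (I n)) (hX : ∀ n, Measurable (X n)) {n t : ℕ}
    (ht : t ∈ Finset.Ico 1 n) : Measurable[history I X hI hX n] (I t) :=
  measurable_fst.comp (measurable_iff_comap_le.2 (comap_le_history hI hX ht))

theorem measurable_reward_history (hI : ∀ n, Measurable (I n)) (hX : ∀ n, Measurable (X n))
    {n t : ℕ} (ht : t ∈ Finset.Ico 1 n) : Measurable[history I X hI hX n] (X t) :=
  measurable_snd.comp (measurable_iff_comap_le.2 (comap_le_history hI hX ht))

/-- The σ-algebra `σ(F_n, I_n)` of what is known just before the reward of round `n` is drawn. -/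
abbrev pullHistory (hI : ∀ n, Measurable (I n)) (hX : ∀ n, Measurable (X n)) (n : ℕ) :
    MeasurableSpace Ω :=
  history I X hI hX n ⊔ MeasurableSpace.comap (I n) inferInstance

theorem history_le_pullHistory (hI : ∀ n, Measurable (I n)) (hX : ∀ n, Measurable (X n)) (n : ℕ) :
    history I X hI hX n ≤ pullHistory hI hX n :=
  le_sup_left

theorem pullHistory_le (hI : ∀ n, Measurable (I n)) (hX : ∀ n, Measurable (X n)) (n : ℕ) :
    pullHistory hI hX n ≤ mΩ :=
  sup_le ((history I X hI hX).le n) (hI n).comap_le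

theorem measurable_arm_pullHistory (hI : ∀ n, Measurable (I n)) (hX : ∀ n, Measurable (X n))
    (n : ℕ) : Measurable[pullHistory hI hX n] (I n) :=
  measurable_iff_comap_le.2 le_sup_right

theorem pullHistory_le_history (hI : ∀ n, Measurable (I n)) (hX : ∀ n, Measurable (X n))
    {n t : ℕ} (ht : t ∈ Finset.Ico 1 n) : pullHistory hI hX t ≤ history I X hI hX n :=
  sup_le ((history I X hI hX).mono (Finset.mem_Ico.1 ht).2.le)
    (measurable_arm_history hI hX ht).comap_le

theorem measurable_logWeight_history (hI : ∀ n, Measurable (I n)) (hX : ∀ n, Measurable (X n))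
    {L : ℕ → Ω → ℝ} (hL : ∀ n, 1 ≤ n → Measurable[pullHistory hI hX n] (L n)) (μ : Fin K → ℝ)
    (n : ℕ) : Measurable[history I X hI hX n] (logWeight μ L I X n) := by
  refine Finset.measurable_sum _ fun t ht => ?_
  have hLt := (hL t (Finset.mem_Ico.1 ht).1).mono (pullHistory_le_history hI hX ht) le_rfl
  exact (hLt.mul ((measurable_reward_history hI hX ht).sub
    ((measurable_of_finite μ).comp (measurable_arm_history hI hX ht)))).sub
      ((hLt.pow_const 2).div_const 2)

theorem measurable_firstPullsWeight (hI : ∀ n, Measurable (I n)) (hX : ∀ n, Measurable (X n))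
    (a : Fin K → ℕ) (l : Fin K → ℝ) (n : ℕ) :
    Measurable[pullHistory hI hX n] (firstPullsWeight a l I n) := by
  have hpulls : Measurable[pullHistory hI hX n] fun ω k => pulls I n k ω :=
    @measurable_pi_lambda _ _ _ (_) _ _ fun k =>
      (measurable_pulls (fun t ht => measurable_arm_history hI hX ht) k).mono
        (history_le_pullHistory hI hX n) le_rfl
  exact (Measurable.of_discrete (f := fun p : Fin K × (Fin K → ℕ) =>
    if p.2 p.1 < a p.1 then l p.1 else 0)).comp
      ((measurable_arm_pullHistory hI hX n).prodMk hpulls)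

end History

theorem lintegral_exp_le_one {ρ : Measure ℝ} (hρ : IsOneSubGaussian ρ) (l : ℝ) :
    ∫⁻ x, ENNReal.ofReal (Real.exp (l * (x - ∫ y, y ∂ρ) - l ^ 2 / 2)) ∂ρ ≤ 1 := by
  simp_rw [sub_eq_add_neg _ (l ^ 2 / 2), Real.exp_add]
  rw [← ofReal_integral_eq_lintegral_ofReal ((hρ.integrable_exp_mul l).mul_const _)
    (Eventually.of_forall fun x => by positivity), ENNReal.ofReal_le_one, integral_mul_const]
  calc (∫ x, Real.exp (l * (x - ∫ y, y ∂ρ)) ∂ρ) * Real.exp (-(l ^ 2 / 2))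
      ≤ Real.exp ((1 : ℝ≥0) * l ^ 2 / 2) * Real.exp (-(l ^ 2 / 2)) :=
        mul_le_mul_of_nonneg_right (hρ.mgf_le l) (Real.exp_pos _).le
    _ = 1 := by rw [← Real.exp_add]; simp

/-- The width `√(2 f (1/x + 1/y))` of the confidence interval at level `e^{-f}` for the difference
of two means estimated from `x` and `y` samples. -/
noncomputable def confWidth (f x y : ℝ) : ℝ := Real.sqrt (2 * f) * Real.sqrt (1 / x + 1 / y)

/-- The reward model of a bandit algorithm, whatever its sampling rule: given the history before
time `n` and the pulled arm `I_n`, the reward `X_n` has law `ν_{I_n}`. -/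
structure IsBanditRun {Ω : Type*} {K : ℕ} [MeasurableSpace Ω] (P : Measure Ω)
    (ν : Fin K → Measure ℝ) (I : ℕ → Ω → Fin K) (X : ℕ → Ω → ℝ) : Prop where
  measurable_arm : ∀ n, Measurable (I n)
  measurable_reward : ∀ n, Measurable (X n)
  reward_law : ∀ n, 1 ≤ n → ∀ s : Set ℝ, MeasurableSet s →
    P⟦X n ⁻¹' s | pullHistory measurable_arm measurable_reward n⟧
      =ᵐ[P] fun ω => (ν (I n ω)).real s

namespace IsBanditRun

variable {Ω : Type*} {K : ℕ} [mΩ : MeasurableSpace Ω] {P : Measure Ω} [IsProbabilityMeasure P]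
  {ν : Fin K → Measure ℝ} [∀ k, IsProbabilityMeasure (ν k)] {I : ℕ → Ω → Fin K} {X : ℕ → Ω → ℝ}

theorem measure_inter_reward (h : IsBanditRun P ν I X) {n : ℕ} (hn : 1 ≤ n) {k : Fin K}
    {A : Set Ω} (hA : MeasurableSet[pullHistory h.measurable_arm h.measurable_reward n] A)
    (hAk : A ⊆ I n ⁻¹' {k}) {s : Set ℝ} (hs : MeasurableSet s) :
    P (A ∩ X n ⁻¹' s) = P A * ν k s := by
  have hle := pullHistory_le h.measurable_arm h.measurable_reward n
  have hXs : MeasurableSet (X n ⁻¹' s) := h.measurable_reward n hs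
  have hcond : ∫ ω in A, (ν (I n ω)).real s ∂P
      = ∫ ω in A, (X n ⁻¹' s).indicator (fun _ => (1 : ℝ)) ω ∂P := by
    rw [← setIntegral_condExp hle ((integrable_const (1 : ℝ)).indicator hXs) hA]
    exact integral_congr_ae (ae_restrict_of_ae (h.reward_law n hn s hs).symm)
  rw [setIntegral_congr_fun (g := fun _ => (ν k).real s) (hle _ hA)
      (fun ω hω => by rw [show I n ω = k from hAk hω]), setIntegral_const,
    integral_indicator hXs, setIntegral_const, measureReal_restrict_apply hXs] at hcond
  rw [← ENNReal.toReal_eq_toReal_iff' (by finiteness) (by finiteness), ENNReal.toReal_mul,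
    Set.inter_comm]
  simpa [Measure.real] using hcond.symm

theorem map_restrict_eq_prod (h : IsBanditRun P ν I X) {n : ℕ} (hn : 1 ≤ n) (k : Fin K)
    {E : Type*} [MeasurableSpace E] {Y : Ω → E}
    (hY : Measurable[pullHistory h.measurable_arm h.measurable_reward n] Y) :
    (P.restrict (I n ⁻¹' {k})).map (fun ω => (Y ω, X n ω))
      = ((P.restrict (I n ⁻¹' {k})).map Y).prod (ν k) := by
  have hYm : Measurable Y := hY.mono (pullHistory_le _ _ n) le_rfl
  refine (Measure.prod_eq fun s t hs ht => ?_).symm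
  have hA := (hY hs).inter
    (measurable_arm_pullHistory h.measurable_arm h.measurable_reward n (measurableSet_singleton k))
  rw [Measure.map_apply (hYm.prodMk (h.measurable_reward n)) (hs.prod ht),
    Measure.map_apply hYm hs,
    Measure.restrict_apply ((hYm.prodMk (h.measurable_reward n)) (hs.prod ht)),
    Measure.restrict_apply (hYm hs), ← h.measure_inter_reward hn hA Set.inter_subset_right ht,
    Set.mk_preimage_prod, Set.inter_right_comm]

theorem setLIntegral_exp_le (h : IsBanditRun P ν I X) (hsub : ∀ k, IsOneSubGaussian (ν k))
    {n : ℕ} (hn : 1 ≤ n) (k : Fin K) {W L : Ω → ℝ}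
    (hW : Measurable[pullHistory h.measurable_arm h.measurable_reward n] W)
    (hL : Measurable[pullHistory h.measurable_arm h.measurable_reward n] L) :
    ∫⁻ ω in I n ⁻¹' {k},
        ENNReal.ofReal (Real.exp (W ω + (L ω * (X n ω - armMean ν k) - L ω ^ 2 / 2))) ∂P
      ≤ ∫⁻ ω in I n ⁻¹' {k}, ENNReal.ofReal (Real.exp (W ω)) ∂P := by
  have hle := pullHistory_le h.measurable_arm h.measurable_reward n
  have hWL : Measurable fun ω => (W ω, L ω) := (hW.mono hle le_rfl).prodMk (hL.mono hle le_rfl)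
  let F : (ℝ × ℝ) × ℝ → ℝ≥0∞ := fun p => ENNReal.ofReal (Real.exp p.1.1) *
    ENNReal.ofReal (Real.exp (p.1.2 * (p.2 - armMean ν k) - p.1.2 ^ 2 / 2))
  have hF : Measurable F := by fun_prop
  calc ∫⁻ ω in I n ⁻¹' {k},
        ENNReal.ofReal (Real.exp (W ω + (L ω * (X n ω - armMean ν k) - L ω ^ 2 / 2))) ∂P
      = ∫⁻ p, F p ∂((P.restrict (I n ⁻¹' {k})).map fun ω => ((W ω, L ω), X n ω)) := by
        rw [lintegral_map hF (hWL.prodMk (h.measurable_reward n))]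
        simp only [F, Real.exp_add, ENNReal.ofReal_mul (Real.exp_pos _).le]
    _ = ∫⁻ ω in I n ⁻¹' {k}, ∫⁻ x, F ((W ω, L ω), x) ∂(ν k) ∂P := by
        rw [h.map_restrict_eq_prod hn k (hW.prodMk hL), lintegral_prod _ hF.aemeasurable,
          lintegral_map hF.lintegral_prod_right' hWL]
    _ ≤ ∫⁻ ω in I n ⁻¹' {k}, ENNReal.ofReal (Real.exp (W ω)) ∂P := by
        refine lintegral_mono fun ω => ?_
        simp only [F]
        rw [lintegral_const_mul' _ _ ENNReal.ofReal_ne_top]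
        exact mul_le_of_le_one_right' (lintegral_exp_le_one (hsub k) _)

/-- The exponential weights form a supermartingale: integrate out the last reward, separately on
each event `I_n = k`. -/
theorem lintegral_exp_logWeight_le_one (h : IsBanditRun P ν I X)
    (hsub : ∀ k, IsOneSubGaussian (ν k)) {L : ℕ → Ω → ℝ}
    (hL : ∀ n, 1 ≤ n → Measurable[pullHistory h.measurable_arm h.measurable_reward n] (L n))
    (n : ℕ) :
    ∫⁻ ω, ENNReal.ofReal (Real.exp (logWeight (armMean ν) L I X n ω)) ∂P ≤ 1 := by
  induction n with
  | zero => simp [logWeight]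
  | succ n ih =>
    rcases Nat.eq_zero_or_pos n with rfl | hn
    · simp [logWeight]
    refine le_trans ?_ ih
    have hdisjoint : Pairwise (Function.onFun Disjoint fun k : Fin K => I n ⁻¹' {k}) :=
      fun a b hab => Disjoint.preimage _ (by simpa using hab)
    have hsum (φ : Ω → ℝ≥0∞) : ∫⁻ ω, φ ω ∂P = ∑' k, ∫⁻ ω in I n ⁻¹' {k}, φ ω ∂P := by
      rw [← lintegral_iUnion (fun k => h.measurable_arm n (measurableSet_singleton k)) hdisjoint,
        ← Set.preimage_iUnion, Set.iUnion_of_singleton, Set.preimage_univ, setLIntegral_univ]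
    rw [hsum, hsum]
    refine ENNReal.tsum_le_tsum fun k => ?_
    have hW := (measurable_logWeight_history h.measurable_arm h.measurable_reward hL
      (armMean ν) n).mono (history_le_pullHistory _ _ n) le_rfl
    refine le_trans (le_of_eq ?_) (h.setLIntegral_exp_le hsub hn k hW (hL n hn))
    refine setLIntegral_congr_fun (h.measurable_arm n (measurableSet_singleton k)) fun ω hω => ?_
    have hωk : I n ω = k := hω
    simp only [logWeight, Finset.sum_Ico_succ_top hn, hωk]

theorem measure_le_logWeight (h : IsBanditRun P ν I X) (hsub : ∀ k, IsOneSubGaussian (ν k))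
    {L : ℕ → Ω → ℝ}
    (hL : ∀ n, 1 ≤ n → Measurable[pullHistory h.measurable_arm h.measurable_reward n] (L n))
    (n : ℕ) (f : ℝ) :
    P {ω | f ≤ logWeight (armMean ν) L I X n ω} ≤ ENNReal.ofReal (Real.exp (-f)) := by
  have hmeas : Measurable (logWeight (armMean ν) L I X n) :=
    (measurable_logWeight_history h.measurable_arm h.measurable_reward hL _ n).mono
      ((history I X _ _).le n) le_rfl
  have hmarkov := (mul_meas_ge_le_lintegral (μ := P)
    (Real.measurable_exp.comp hmeas).ennreal_ofReal (ENNReal.ofReal (Real.exp f))).trans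
      (h.lintegral_exp_logWeight_le_one hsub hL n)
  simp only [Function.comp_apply, ENNReal.ofReal_le_ofReal_iff (Real.exp_pos _).le,
    Real.exp_le_exp] at hmarkov
  rw [Real.exp_neg, ENNReal.ofReal_inv_of_pos (Real.exp_pos f)]
  exact ENNReal.le_inv_iff_mul_le.2 (by rwa [mul_comm])

theorem measure_empMean_deviation_le (h : IsBanditRun P ν I X)
    (hsub : ∀ k, IsOneSubGaussian (ν k)) (a : Fin K → ℕ) (l : Fin K → ℝ) (f : ℝ) :
    P {ω | ∃ t, (∀ k, a k = 0 ∨ pulls I t k ω = a k) ∧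
        f ≤ ∑ k, a k * (l k * (empMean I X t k ω - armMean ν k) - l k ^ 2 / 2)}
      ≤ ENNReal.ofReal (Real.exp (-f)) := by
  set D : ℕ → Set Ω := fun T => {ω | ∃ t ≤ T, (∀ k, a k = 0 ∨ pulls I t k ω = a k) ∧
    f ≤ ∑ k, a k * (l k * (empMean I X t k ω - armMean ν k) - l k ^ 2 / 2)}
  have hmono : Monotone D := fun T T' hT ω ⟨t, ht, hdev⟩ => ⟨t, ht.trans hT, hdev⟩
  have hcover : {ω | ∃ t, (∀ k, a k = 0 ∨ pulls I t k ω = a k) ∧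
      f ≤ ∑ k, a k * (l k * (empMean I X t k ω - armMean ν k) - l k ^ 2 / 2)} ⊆ ⋃ T, D T := by
    rintro ω ⟨t, hdev⟩
    exact Set.mem_iUnion.2 ⟨t, t, le_rfl, hdev⟩
  refine (measure_mono hcover).trans ?_
  rw [hmono.measure_iUnion]
  refine iSup_le fun T => (measure_mono ?_).trans
    (h.measure_le_logWeight hsub (fun n _ => measurable_firstPullsWeight _ _ a l n) T f)
  rintro ω ⟨t, ht, ha, hdev⟩
  rwa [Set.mem_ofPred_eq, logWeight_firstPullsWeight _ a l I X ht ha]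

theorem measure_empMean_sub_le (h : IsBanditRun P ν I X) (hsub : ∀ k, IsOneSubGaussian (ν k))
    {i j : Fin K} (hij : i ≠ j) {a b : ℕ} (ha : 1 ≤ a) (hb : 1 ≤ b) {f : ℝ} (hf : 0 ≤ f) :
    P {ω | ∃ t, pulls I t i ω = a ∧ pulls I t j ω = b ∧
        confWidth f a b ≤ (empMean I X t i ω - armMean ν i) - (empMean I X t j ω - armMean ν j)}
      ≤ ENNReal.ofReal (Real.exp (-f)) := by
  have ha_pos : (0 : ℝ) < a := by exact_mod_cast ha
  have hb_pos : (0 : ℝ) < b := by exact_mod_cast hb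
  have hsum : (0 : ℝ) < 1 / a + 1 / b := add_pos (one_div_pos.2 ha_pos) (one_div_pos.2 hb_pos)
  -- `c` maximizes `c w - c² (1/a + 1/b) / 2` over the parameters, at the width `w` of the interval
  set c := Real.sqrt (2 * f) / Real.sqrt (1 / (a : ℝ) + 1 / b) with hc
  have hc_width : c * confWidth f a b = 2 * f := by
    rw [hc, confWidth, mul_left_comm, div_mul_cancel₀ _ (Real.sqrt_pos.2 hsum).ne',
      Real.mul_self_sqrt (by positivity)]
  have hc_sq : c ^ 2 * (1 / (a : ℝ) + 1 / b) = 2 * f := by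
    rw [hc, div_pow, Real.sq_sqrt hsum.le, Real.sq_sqrt (by positivity),
      div_mul_cancel₀ _ hsum.ne']
  set p : Fin K → ℕ := fun k => if k = i then a else if k = j then b else 0
  set l : Fin K → ℝ := fun k => if k = i then c / a else -(c / b)
  refine (measure_mono ?_).trans (h.measure_empMean_deviation_le hsub p l f)
  rintro ω ⟨t, hti, htj, hdev⟩
  refine ⟨t, fun k => ?_, ?_⟩
  · simp only [p]
    split_ifs with hki hkj
    · exact .inr (hki ▸ hti)
    · exact .inr (hkj ▸ htj)
    · exact .inl rfl
  · rw [Fintype.sum_eq_add i j hij fun k hk => by simp [p, hk.1, hk.2]]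
    simp only [p, l, if_true, if_neg hij.symm]
    have hvalue : a * (c / a * (empMean I X t i ω - armMean ν i) - (c / a) ^ 2 / 2)
          + b * (-(c / b) * (empMean I X t j ω - armMean ν j) - (-(c / b)) ^ 2 / 2)
        = c * ((empMean I X t i ω - armMean ν i) - (empMean I X t j ω - armMean ν j))
          - c ^ 2 * (1 / (a : ℝ) + 1 / b) / 2 := by
      field_simp
      ring
    have hmul := mul_le_mul_of_nonneg_left hdev (show 0 ≤ c by positivity)
    linarith

theorem measure_mul_empMean_sub_le (h : IsBanditRun P ν I X) (hsub : ∀ k, IsOneSubGaussian (ν k))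
    (k : Fin K) {σ : ℝ} (hσ : σ ^ 2 = 1) (a : ℕ) {y : ℝ} (hy : 0 ≤ y) :
    P {ω | ∃ t, pulls I t k ω = a ∧ y ≤ σ * (empMean I X t k ω - armMean ν k)}
      ≤ ENNReal.ofReal (Real.exp (-(a * (y ^ 2 / 2)))) := by
  refine (measure_mono ?_).trans
    (h.measure_empMean_deviation_le hsub (Pi.single k a) (fun _ => σ * y) (a * (y ^ 2 / 2)))
  rintro ω ⟨t, htk, hdev⟩
  refine ⟨t, fun k' => ?_, ?_⟩
  · rcases eq_or_ne k' k with rfl | hne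
    · exact .inr (by simp [htk])
    · exact .inl (by simp [hne])
  · rw [Fintype.sum_eq_single k fun k' hk' => by simp [hk'], Pi.single_eq_same, mul_pow, hσ,
      one_mul]
    have hmul := mul_le_mul_of_nonneg_left hdev hy
    gcongr
    linarith

end IsBanditRun

theorem tsum_exp_neg_add_mul_le {c f : ℝ} (hc : 0 < c) {N : ℕ} (hN : f ≤ N * c) :
    ∑' m : ℕ, ENNReal.ofReal (Real.exp (-((N + m : ℕ) * c)))
      ≤ ENNReal.ofReal ((1 + 1 / c) * Real.exp (-f)) := by
  have hratio : Real.exp (-c) < 1 := Real.exp_lt_one_iff.2 (by linarith)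
  have hgeom (m : ℕ) :
      Real.exp (-((N + m : ℕ) * c)) = Real.exp (-(N * c)) * Real.exp (-c) ^ m := by
    rw [← Real.exp_nat_mul, ← Real.exp_add]
    push_cast
    ring_nf
  have hinv : (1 - Real.exp (-c))⁻¹ ≤ 1 + 1 / c := by
    have hexp : Real.exp (-c) ≤ 1 / (1 + c) := by
      rw [Real.exp_neg, ← one_div]
      exact one_div_le_one_div_of_le (by linarith) (by linarith [Real.add_one_le_exp c])
    have hone : (1 + 1 / c)⁻¹ = 1 - 1 / (1 + c) := by
      field_simp
      ring
    rw [inv_le_comm₀ (by linarith) (by positivity)]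
    linarith
  simp_rw [hgeom]
  rw [← ENNReal.ofReal_tsum_of_nonneg (fun m => by positivity)
      ((summable_geometric_of_lt_one (Real.exp_pos _).le hratio).mul_left _),
    tsum_mul_left, tsum_geometric_of_lt_one (Real.exp_pos _).le hratio, mul_comm]
  gcongr

theorem IsBanditRun.measure_forall_mul_empMean_sub_le {Ω : Type*} {K : ℕ} [MeasurableSpace Ω]
    {P : Measure Ω} [IsProbabilityMeasure P] {ν : Fin K → Measure ℝ}
    [∀ k, IsProbabilityMeasure (ν k)] {I : ℕ → Ω → Fin K} {X : ℕ → Ω → ℝ}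
    (h : IsBanditRun P ν I X) (hsub : ∀ k, IsOneSubGaussian (ν k)) (k : Fin K) {σ : ℝ}
    (hσ : σ ^ 2 = 1) {y : ℝ} (hy : 0 < y) (f : ℝ) :
    P {ω | ∃ t, f ≤ pulls I t k ω * (y ^ 2 / 2) ∧ y ≤ σ * (empMean I X t k ω - armMean ν k)}
      ≤ ENNReal.ofReal ((1 + 1 / (y ^ 2 / 2)) * Real.exp (-f)) := by
  have hc : 0 < y ^ 2 / 2 := by positivity
  set N := ⌈f / (y ^ 2 / 2)⌉₊
  have hcover : {ω | ∃ t, f ≤ pulls I t k ω * (y ^ 2 / 2) ∧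
        y ≤ σ * (empMean I X t k ω - armMean ν k)}
      ⊆ ⋃ m : ℕ, {ω | ∃ t, pulls I t k ω = N + m ∧
        y ≤ σ * (empMean I X t k ω - armMean ν k)} := by
    rintro ω ⟨t, hpulls, hdev⟩
    have hN : N ≤ pulls I t k ω := Nat.ceil_le.2 ((div_le_iff₀ hc).2 hpulls)
    exact Set.mem_iUnion.2 ⟨pulls I t k ω - N, t, by omega, hdev⟩
  calc _ ≤ _ := measure_mono hcover
    _ ≤ ∑' m : ℕ, _ := measure_iUnion_le _
    _ ≤ ∑' m : ℕ, ENNReal.ofReal (Real.exp (-((N + m : ℕ) * (y ^ 2 / 2)))) :=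
        ENNReal.tsum_le_tsum fun m => h.measure_mul_empMean_sub_le hsub k hσ (N + m) hy.le
    _ ≤ _ := tsum_exp_neg_add_mul_le hc ((div_le_iff₀ hc).1 (Nat.le_ceil _))

/-! ### Counting rounds -/

/-- The sampling rule of EB-TC with proportion `1/2` at the outcome `ω`, whatever the choice of the
leaders `B` and of the challengers `C`. -/
structure IsHalfTracking {Ω : Type*} {K : ℕ} (B C I : ℕ → Ω → Fin K) (ω : Ω) : Prop where
  init : ∀ k, ∃ t ∈ Finset.Icc 1 K, I t ω = k
  challenger_ne : ∀ n, K < n → C n ω ≠ B n ω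
  pull_challenger : ∀ n, K < n →
    2 * challengerPulls B C I n (B n ω) (C n ω) ω ≤ pairCount B C (n + 1) (B n ω) (C n ω) ω →
    I n ω = C n ω
  pull_leader : ∀ n, K < n →
    pairCount B C (n + 1) (B n ω) (C n ω) ω < 2 * challengerPulls B C I n (B n ω) (C n ω) ω →
    I n ω = B n ω

/-- The number of rounds before time `n`, after the initialization, in which the process `B` (the
leader or the challenger) is `k`. -/
def roundCount {Ω : Type*} {K : ℕ} (B : ℕ → Ω → Fin K) (n : ℕ) (k : Fin K) (ω : Ω) : ℕ :=
  ((Finset.Ioo K n).filter (fun t => B t ω = k)).card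

theorem card_filter_Ioo_succ {m n : ℕ} (hmn : m < n) (p : ℕ → Prop) [DecidablePred p] :
    ((Finset.Ioo m (n + 1)).filter p).card
      = ((Finset.Ioo m n).filter p).card + if p n then 1 else 0 := by
  have hinsert : Finset.Ioo m (n + 1) = insert n (Finset.Ioo m n) := by
    ext t
    simp only [Finset.mem_Ioo, Finset.mem_insert]
    omega
  rw [hinsert, Finset.filter_insert]
  split_ifs with hp
  · rw [Finset.card_insert_of_notMem (by simp)]
  · simp

theorem sum_card_filter_and_eq {α β : Type*} [Fintype β] [DecidableEq β] (s : Finset α)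
    (p : α → Prop) [DecidablePred p] (f : α → β) :
    ∑ b, (s.filter (fun t => p t ∧ f t = b)).card = (s.filter p).card := by
  rw [Finset.card_eq_sum_card_fiberwise (f := f) (t := Finset.univ) (by simp)]
  simp [Finset.filter_filter]

theorem exists_mem_card_le_card_filter_Ioo_add_one {S : Finset ℕ} (hS : S.Nonempty) {m T : ℕ}
    {p : ℕ → Prop} [DecidablePred p] (hsub : S ⊆ (Finset.Ioo m T).filter p) :
    ∃ n ∈ S, m < n ∧ S.card ≤ ((Finset.Ioo m n).filter p).card + 1 := by
  have hmax := S.max'_mem hS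
  refine ⟨S.max' hS, hmax, (Finset.mem_Ioo.1 (Finset.mem_filter.1 (hsub hmax)).1).1, ?_⟩
  rw [← Finset.card_erase_add_one hmax]
  refine Nat.add_le_add_right (Finset.card_le_card fun t ht => ?_) 1
  have htS := Finset.mem_of_mem_erase ht
  obtain ⟨hIoo, hp⟩ := Finset.mem_filter.1 (hsub htS)
  have hlt := lt_of_le_of_ne (S.le_max' t htS) (Finset.ne_of_mem_erase ht)
  exact Finset.mem_filter.2 ⟨Finset.mem_Ioo.2 ⟨(Finset.mem_Ioo.1 hIoo).1, hlt⟩, hp⟩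

namespace IsHalfTracking

variable {Ω : Type*} {K : ℕ} {B C I : ℕ → Ω → Fin K} {ω : Ω}

theorem two_le (h : IsHalfTracking B C I ω) : 2 ≤ K := by
  have hne := h.challenger_ne (K + 1) K.lt_succ_self
  rw [← Fintype.card_fin K]
  exact Fintype.one_lt_card_iff.2 ⟨_, _, hne⟩

theorem one_add_card_filter_le_pulls (h : IsHalfTracking B C I ω) {n : ℕ} (hn : K < n)
    (k : Fin K) :
    1 + ((Finset.Ioo K n).filter (fun t => I t ω = k)).card ≤ pulls I n k ω := by
  obtain ⟨t, ht, hk⟩ := h.init k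
  rw [Finset.mem_Icc] at ht
  rw [pulls, add_comm, ← Finset.card_insert_of_notMem (a := t)
    (by simp only [Finset.mem_filter, Finset.mem_Ioo]; omega)]
  refine Finset.card_le_card fun s hs => ?_
  simp only [Finset.mem_insert, Finset.mem_filter, Finset.mem_Ioo, Finset.mem_Ico] at hs ⊢
  rcases hs with rfl | hs
  · exact ⟨by omega, hk⟩
  · exact ⟨by omega, hs.2⟩

/-- Tracking keeps `2 N^i_{n,j} - T_n(i,j)` in `{0, 1, 2}`: a round of the pair `(i, j)` adds `1`
to this difference if `2 N^i_{n,j} ≤ T_n(i,j) + 1`, and subtracts `1` otherwise. -/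
theorem pairCount_le_and_le (h : IsHalfTracking B C I ω) (n : ℕ) (i j : Fin K) :
    pairCount B C n i j ω ≤ 2 * challengerPulls B C I n i j ω ∧
      2 * challengerPulls B C I n i j ω ≤ pairCount B C n i j ω + 2 := by
  induction n with
  | zero => simp [challengerPulls, pairCount]
  | succ n ih =>
    rcases le_or_gt n K with hn | hn
    · have hempty : Finset.Ioo K (n + 1) = ∅ := by
        ext t
        simp only [Finset.mem_Ioo, Finset.notMem_empty, iff_false]
        omega
      simp [challengerPulls, pairCount, hempty]
    have hpair : pairCount B C (n + 1) i j ω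
        = pairCount B C n i j ω + if B n ω = i ∧ C n ω = j then 1 else 0 :=
      card_filter_Ioo_succ hn _
    have hchallenger : challengerPulls B C I (n + 1) i j ω = challengerPulls B C I n i j ω
        + if (B n ω = i ∧ C n ω = j) ∧ I n ω = j then 1 else 0 :=
      card_filter_Ioo_succ hn _
    by_cases hround : B n ω = i ∧ C n ω = j
    · obtain ⟨rfl, rfl⟩ := hround
      simp only [and_self, true_and, if_true] at hpair hchallenger
      rcases le_or_gt (2 * challengerPulls B C I n (B n ω) (C n ω) ω)
        (pairCount B C (n + 1) (B n ω) (C n ω) ω) with hle | hlt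
      · rw [if_pos (h.pull_challenger n hn hle)] at hchallenger
        omega
      · rw [h.pull_leader n hn hlt, if_neg (h.challenger_ne n hn).symm] at hchallenger
        omega
    · rw [if_neg hround] at hpair
      rw [if_neg fun hpull => hround hpull.1] at hchallenger
      omega

theorem challengerPulls_self (h : IsHalfTracking B C I ω) (n : ℕ) (i : Fin K) :
    challengerPulls B C I n i i ω = 0 := by
  rw [challengerPulls, Finset.card_eq_zero, Finset.filter_eq_empty_iff]
  rintro t ht ⟨⟨hB, hC⟩, -⟩
  exact h.challenger_ne t (Finset.mem_Ioo.1 ht).1 (hC.trans hB.symm)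

theorem roundCount_leader_add_two_le (h : IsHalfTracking B C I ω) (n : ℕ) (k : Fin K) :
    roundCount B n k ω + 2 ≤
      2 * ((Finset.Ioo K n).filter (fun t => B t ω = k ∧ I t ω ≠ C t ω)).card + 2 * K := by
  have hpairs : ∑ j, pairCount B C n k j ω = roundCount B n k ω :=
    sum_card_filter_and_eq _ (fun t => B t ω = k) (fun t => C t ω)
  have hchallenger : ∑ j, challengerPulls B C I n k j ω
      = ((Finset.Ioo K n).filter (fun t => B t ω = k ∧ I t ω = C t ω)).card := by
    rw [← sum_card_filter_and_eq _ (fun t => B t ω = k ∧ I t ω = C t ω) (fun t => C t ω)]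
    refine Finset.sum_congr rfl fun j _ => congrArg _ (Finset.filter_congr fun t _ => ?_)
    exact ⟨fun ⟨⟨hB, hC⟩, hI⟩ => ⟨⟨hB, hI.trans hC.symm⟩, hC⟩,
      fun ⟨⟨hB, hI⟩, hC⟩ => ⟨⟨hB, hC⟩, hI.trans hC⟩⟩
  have hsplit : roundCount B n k ω
      = ((Finset.Ioo K n).filter (fun t => B t ω = k ∧ I t ω = C t ω)).card
        + ((Finset.Ioo K n).filter (fun t => B t ω = k ∧ I t ω ≠ C t ω)).card := by
    rw [roundCount, ← Finset.card_filter_add_card_filter_not (fun t => I t ω = C t ω),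
      Finset.filter_filter, Finset.filter_filter]
  -- the pair `(k, k)` never occurs, which saves `2`
  have hsum : ∑ j, 2 * challengerPulls B C I n k j ω + 2
      ≤ ∑ j, (pairCount B C n k j ω + 2) := by
    rw [← Finset.add_sum_erase _ _ (Finset.mem_univ k),
      ← Finset.add_sum_erase _ _ (Finset.mem_univ k), h.challengerPulls_self n k]
    have hle := Finset.sum_le_sum (s := Finset.univ.erase k)
      fun j _ => (h.pairCount_le_and_le n k j).2
    omega
  rw [← Finset.mul_sum, Finset.sum_add_distrib, hpairs, hchallenger, Finset.sum_const,
    Finset.card_univ, Fintype.card_fin, smul_eq_mul] at hsum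
  omega

theorem roundCount_challenger_le (h : IsHalfTracking B C I ω) (n : ℕ) (k : Fin K) :
    roundCount C n k ω ≤
      2 * ((Finset.Ioo K n).filter (fun t => C t ω = k ∧ I t ω = k)).card := by
  have hpairs : ∑ i, pairCount B C n i k ω = roundCount C n k ω := by
    rw [roundCount, ← sum_card_filter_and_eq _ (fun t => C t ω = k) (fun t => B t ω)]
    exact Finset.sum_congr rfl fun j _ => congrArg _ (Finset.filter_congr fun t _ => and_comm)
  have hchallenger : ∑ i, challengerPulls B C I n i k ω
      = ((Finset.Ioo K n).filter (fun t => C t ω = k ∧ I t ω = k)).card := by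
    rw [← sum_card_filter_and_eq _ (fun t => C t ω = k ∧ I t ω = k) (fun t => B t ω)]
    refine Finset.sum_congr rfl fun j _ => congrArg _ (Finset.filter_congr fun t _ => ?_)
    tauto
  rw [← hpairs, ← hchallenger, Finset.mul_sum]
  exact Finset.sum_le_sum fun i _ => (h.pairCount_le_and_le n i k).1

theorem one_add_card_add_card_le_pulls (h : IsHalfTracking B C I ω) {n : ℕ} (hn : K < n)
    (k : Fin K) :
    1 + (((Finset.Ioo K n).filter (fun t => B t ω = k ∧ I t ω ≠ C t ω)).card
      + ((Finset.Ioo K n).filter (fun t => C t ω = k ∧ I t ω = k)).card) ≤ pulls I n k ω := by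
  refine le_trans (Nat.add_le_add_left ?_ 1) (h.one_add_card_filter_le_pulls hn k)
  rw [← Finset.card_union_of_disjoint]
  · refine Finset.card_le_card fun t => ?_
    simp only [Finset.mem_union, Finset.mem_filter]
    rintro (⟨ht, rfl, hne⟩ | ⟨ht, -, hI⟩)
    · have hKt := (Finset.mem_Ioo.1 ht).1
      exact ⟨ht, h.pull_leader t hKt (lt_of_not_ge fun hle => hne (h.pull_challenger t hKt hle))⟩
    · exact ⟨ht, hI⟩
  · rw [Finset.disjoint_left]
    simp only [Finset.mem_filter]
    rintro t ⟨-, -, hne⟩ ⟨-, hC, hI⟩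
    exact hne (hI.trans hC.symm)

theorem roundCount_add_roundCount_le (h : IsHalfTracking B C I ω) {n : ℕ} (hn : K < n)
    (k : Fin K) :
    roundCount B n k ω + roundCount C n k ω + 4 ≤ 2 * pulls I n k ω + 2 * K := by
  have hB := h.roundCount_leader_add_two_le n k
  have hC := h.roundCount_challenger_le n k
  have hpulls := h.one_add_card_add_card_le_pulls hn k
  omega

theorem roundCount_challenger_add_two_le (h : IsHalfTracking B C I ω) {n : ℕ} (hn : K < n)
    (k : Fin K) : roundCount C n k ω + 2 ≤ 2 * pulls I n k ω := by
  have hC := h.roundCount_challenger_le n k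
  have hpulls := h.one_add_card_add_card_le_pulls hn k
  omega

theorem card_leader_or_challenger_pulls_le (h : IsHalfTracking B C I ω) (T : ℕ) {D : ℝ}
    (hD : 0 ≤ D) (k : Fin K) :
    (((Finset.Ioo K T).filter fun t =>
        (B t ω = k ∨ C t ω = k) ∧ (pulls I t k ω : ℝ) ≤ D).card : ℝ) ≤ 2 * D + (2 * K - 3) := by
  have hK : (2 : ℝ) ≤ K := by exact_mod_cast h.two_le
  set S := (Finset.Ioo K T).filter fun t =>
    (B t ω = k ∨ C t ω = k) ∧ (pulls I t k ω : ℝ) ≤ D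
  rcases S.eq_empty_or_nonempty with hempty | hne
  · rw [hempty, Finset.card_empty, Nat.cast_zero]
    linarith
  obtain ⟨n, hnS, hKn, hcard⟩ := exists_mem_card_le_card_filter_Ioo_add_one hne
    (m := K) (T := T) (p := fun t => B t ω = k ∨ C t ω = k)
    (Finset.monotone_filter_right _ fun _ _ ht => ht.1)
  have hunion := Finset.card_union_le ((Finset.Ioo K n).filter fun t => B t ω = k)
    ((Finset.Ioo K n).filter fun t => C t ω = k)
  rw [← Finset.filter_or] at hunion
  have hrounds := h.roundCount_add_roundCount_le hKn k
  simp only [roundCount] at hrounds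
  have hle : (S.card : ℝ) + 3 ≤ 2 * pulls I n k ω + 2 * K := by
    exact_mod_cast (by omega : S.card + 3 ≤ 2 * pulls I n k ω + 2 * K)
  linarith [(Finset.mem_filter.1 hnS).2.2]

theorem card_challenger_pulls_le (h : IsHalfTracking B C I ω) (T : ℕ) {D : ℝ} (hD : 0 ≤ D)
    (k : Fin K) :
    (((Finset.Ioo K T).filter fun t => C t ω = k ∧ (pulls I t k ω : ℝ) ≤ D).card : ℝ)
      ≤ 2 * D := by
  set S := (Finset.Ioo K T).filter fun t => C t ω = k ∧ (pulls I t k ω : ℝ) ≤ D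
  rcases S.eq_empty_or_nonempty with hempty | hne
  · rw [hempty, Finset.card_empty, Nat.cast_zero]
    linarith
  obtain ⟨n, hnS, hKn, hcard⟩ := exists_mem_card_le_card_filter_Ioo_add_one hne
    (m := K) (T := T) (p := fun t => C t ω = k)
    (Finset.monotone_filter_right _ fun _ _ ht => ht.1)
  have hrounds := h.roundCount_challenger_add_two_le hKn k
  simp only [roundCount] at hrounds
  have hle : (S.card : ℝ) ≤ 2 * pulls I n k ω := by
    exact_mod_cast (by omega : S.card ≤ 2 * pulls I n k ω)
  linarith [(Finset.mem_filter.1 hnS).2.2]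

/-- Attribute each round without well sampled leader and challenger to its leader if this is in
`G` or seldom pulled, and to its challenger otherwise. -/
theorem card_Ioo_le (h : IsHalfTracking B C I ω) {T : ℕ} (hKT : K < T) {D : Fin K → ℝ}
    (hD : ∀ k, 0 ≤ D k) (G : Finset (Fin K))
    (hlow : ∀ t ∈ Finset.Ioo K T, B t ω ∈ G ∨ (pulls I t (B t ω) ω : ℝ) ≤ D (B t ω) ∨
      (pulls I t (C t ω) ω : ℝ) ≤ D (C t ω)) :
    ((Finset.Ioo K T).card : ℝ)
      ≤ 2 * ∑ k, D k + 2 * ∑ k ∈ G, (pulls I T k ω : ℝ) + K * (2 * K - 3) := by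
  let S : Fin K → Finset ℕ := fun k =>
    if k ∈ G then (Finset.Ioo K T).filter (fun t => B t ω = k)
      ∪ (Finset.Ioo K T).filter (fun t => C t ω = k ∧ (pulls I t k ω : ℝ) ≤ D k)
    else (Finset.Ioo K T).filter
      fun t => (B t ω = k ∨ C t ω = k) ∧ (pulls I t k ω : ℝ) ≤ D k
  have hcover : Finset.Ioo K T ⊆ Finset.univ.biUnion S := by
    intro t ht
    rw [Finset.mem_biUnion]
    by_cases hB : B t ω ∈ G
    · exact ⟨B t ω, Finset.mem_univ _, by simp [S, hB, ht]⟩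
    rcases (hlow t ht).resolve_left hB with hlowB | hlowC
    · exact ⟨B t ω, Finset.mem_univ _, by simp [S, hB, ht, hlowB]⟩
    · refine ⟨C t ω, Finset.mem_univ _, ?_⟩
      by_cases hC : C t ω ∈ G <;> simp [S, hC, ht, hlowC]
  have hcard (k : Fin K) : ((S k).card : ℝ)
      ≤ 2 * D k + (if k ∈ G then 2 * (pulls I T k ω : ℝ) else 0) + (2 * K - 3) := by
    by_cases hk : k ∈ G
    · simp only [S, if_pos hk]
      have hunion := Finset.card_union_le ((Finset.Ioo K T).filter (fun t => B t ω = k))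
        ((Finset.Ioo K T).filter (fun t => C t ω = k ∧ (pulls I t k ω : ℝ) ≤ D k))
      have hrounds := h.roundCount_add_roundCount_le hKT k
      rw [roundCount] at hrounds
      have hchallenger := h.card_challenger_pulls_le T (hD k) k
      rify at hunion hrounds
      linarith [(Nat.cast_nonneg (roundCount C T k ω) : (0 : ℝ) ≤ _)]
    · simp only [S, if_neg hk, add_zero]
      exact h.card_leader_or_challenger_pulls_le T (hD k) k
  calc ((Finset.Ioo K T).card : ℝ) ≤ ((Finset.univ.biUnion S).card : ℝ) := by
        exact_mod_cast Finset.card_le_card hcover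
    _ ≤ ∑ k, ((S k).card : ℝ) := by exact_mod_cast Finset.card_biUnion_le
    _ ≤ _ := Finset.sum_le_sum fun k _ => hcard k
    _ = _ := by
      rw [Finset.sum_add_distrib, Finset.sum_add_distrib, Finset.sum_ite_mem, Finset.univ_inter,
        ← Finset.mul_sum, ← Finset.mul_sum, Finset.sum_const, Finset.card_univ, Fintype.card_fin,
        nsmul_eq_mul]

theorem exists_leader_notMem_pulls_gt (h : IsHalfTracking B C I ω) {T : ℕ} {D : Fin K → ℝ}
    (hD : ∀ k, 0 ≤ D k) (G : Finset (Fin K))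
    (hT : 2 * ∑ k, D k + 2 * ∑ k ∈ G, (pulls I T k ω : ℝ) + 5 * (K : ℝ) ^ 2 / 2 < T) :
    ∃ t ∈ Finset.Ioo K T, B t ω ∉ G ∧ D (B t ω) < pulls I t (B t ω) ω ∧
      D (C t ω) < pulls I t (C t ω) ω := by
  have hK : (2 : ℝ) ≤ K := by exact_mod_cast h.two_le
  have hsumD : 0 ≤ ∑ k, D k := Finset.sum_nonneg fun k _ => hD k
  have hsumG : (0 : ℝ) ≤ ∑ k ∈ G, (pulls I T k ω : ℝ) := Finset.sum_nonneg fun k _ => by positivity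
  have hKT : K < T := by
    have : (K : ℝ) < T := by nlinarith
    exact_mod_cast this
  by_contra! hlow
  have hcard := h.card_Ioo_le hKT hD G fun t ht => or_iff_not_imp_left.2 fun hB =>
    or_iff_not_imp_left.2 fun hlt => hlow t ht hB (not_le.1 hlt)
  rw [Nat.card_Ioo, Nat.cast_sub (by omega), Nat.cast_sub hKT.le, Nat.cast_one] at hcard
  nlinarith

end IsHalfTracking

namespace IsEBTCRun

variable {Ω : Type*} {K : ℕ} [MeasurableSpace Ω] {P : Measure Ω} {ν : Fin K → Measure ℝ}
  {ε₀ β : ℝ} {ihat C I : ℕ → Ω → Fin K} {X : ℕ → Ω → ℝ}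

theorem isBanditRun (h : IsEBTCRun P ν ε₀ β ihat C I X) : IsBanditRun P ν I X :=
  ⟨h.measurable_arm, h.measurable_reward, h.reward_law⟩

theorem isHalfTracking (h : IsEBTCRun P ν ε₀ (1 / 2) ihat C I X) (ω : Ω) :
    IsHalfTracking ihat C I ω where
  init := h.init ω
  challenger_ne := h.challenger_ne ω
  pull_challenger n hn hle := h.pull_challenger ω n hn (by rify at hle; linarith)
  pull_leader n hn hlt := h.pull_leader ω n hn (by rify at hlt; linarith)

end IsEBTCRun

/-! ### The concentration event -/

/-- At time `t`, the differences of the empirical means are accurate at level `e^{-f}`. -/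
def HasAccurateDiffs {Ω : Type*} {K : ℕ} (μ : Fin K → ℝ) (I : ℕ → Ω → Fin K) (X : ℕ → Ω → ℝ)
    (f : ℝ) (t : ℕ) (ω : Ω) : Prop :=
  ∀ i j, i ≠ j → (empMean I X t i ω - μ i) - (empMean I X t j ω - μ j) <
    confWidth f (pulls I t i ω) (pulls I t j ω)

/-- The concentration event: the differences of empirical means are accurate until time `T` and,
without limit of time, the empirical mean of an arm `k` that has been pulled `2 f / y_k ^ 2` times
errs by less than `y_k` in the direction `σ_k`. -/
def IsConcentrated {Ω : Type*} {K : ℕ} (μ : Fin K → ℝ) (I : ℕ → Ω → Fin K) (X : ℕ → Ω → ℝ)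
    (T : ℕ) (f : ℝ) (σ y : Fin K → ℝ) (ω : Ω) : Prop :=
  (∀ t, K < t → t ≤ T → HasAccurateDiffs μ I X f t ω) ∧
    ∀ k t, f ≤ pulls I t k ω * (y k ^ 2 / 2) → σ k * (empMean I X t k ω - μ k) < y k

theorem pulls_add_pulls_lt {Ω : Type*} {K : ℕ} (I : ℕ → Ω → Fin K) {i j : Fin K} (hij : i ≠ j)
    {t : ℕ} (ht : 1 ≤ t) (ω : Ω) : pulls I t i ω + pulls I t j ω < t := by
  have hdisj : Disjoint ((Finset.Ico 1 t).filter (fun s => I s ω = i))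
      ((Finset.Ico 1 t).filter (fun s => I s ω = j)) :=
    Finset.disjoint_filter.2 fun s _ hi hj => hij (hi.symm.trans hj)
  have hle : pulls I t i ω + pulls I t j ω ≤ (Finset.Ico 1 t).card := by
    rw [pulls, pulls, ← Finset.card_union_of_disjoint hdisj]
    exact Finset.card_le_card
      (Finset.union_subset (Finset.filter_subset _ _) (Finset.filter_subset _ _))
  rw [Nat.card_Ico] at hle
  omega

theorem one_le_pulls {Ω : Type*} {K : ℕ} {I : ℕ → Ω → Fin K} {ω : Ω} {k : Fin K}
    (hinit : ∃ t ∈ Finset.Icc 1 K, I t ω = k) {n : ℕ} (hn : K < n) : 1 ≤ pulls I n k ω := by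
  obtain ⟨t, ht, hk⟩ := hinit
  rw [Finset.mem_Icc] at ht
  exact Finset.card_pos.2 ⟨t, Finset.mem_filter.2 ⟨Finset.mem_Ico.2 ⟨ht.1, ht.2.trans_lt hn⟩, hk⟩⟩

theorem two_mul_card_sigma_Ico_le (T : ℕ) :
    2 * ((Finset.range T).sigma fun m => Finset.Ico 1 m).card ≤ T ^ 2 := by
  rw [Finset.card_sigma, mul_comm]
  calc (∑ m ∈ Finset.range T, (Finset.Ico 1 m).card) * 2
      ≤ (∑ m ∈ Finset.range T, m) * 2 := by
        gcongr with m
        rw [Nat.card_Ico]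
        omega
    _ = T * (T - 1) := Finset.sum_range_id_mul_two T
    _ ≤ T ^ 2 := by
        rw [sq]
        exact Nat.mul_le_mul_left T (Nat.sub_le T 1)

theorem measure_biUnion_finset_le_card_mul {Ω α : Type*} [MeasurableSpace Ω] {P : Measure Ω}
    {s : Finset α} {S : α → Set Ω} {c : ℝ} (hS : ∀ a ∈ s, P (S a) ≤ ENNReal.ofReal c) :
    P (⋃ a ∈ s, S a) ≤ ENNReal.ofReal (s.card * c) := by
  rw [ENNReal.ofReal_mul (Nat.cast_nonneg _), ENNReal.ofReal_natCast, ← nsmul_eq_mul]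
  exact (measure_biUnion_finset_le _ _).trans (Finset.sum_le_card_nsmul _ _ _ hS)

namespace IsBanditRun

variable {Ω : Type*} {K : ℕ} [MeasurableSpace Ω] {P : Measure Ω} [IsProbabilityMeasure P]
  {ν : Fin K → Measure ℝ} [∀ k, IsProbabilityMeasure (ν k)] {I : ℕ → Ω → Fin K} {X : ℕ → Ω → ℝ}

theorem measure_forall_empMean_sub_le (h : IsBanditRun P ν I X)
    (hinit : ∀ ω k, ∃ t ∈ Finset.Icc 1 K, I t ω = k) (hsub : ∀ k, IsOneSubGaussian (ν k))
    {i j : Fin K} (hij : i ≠ j) (T : ℕ) {f : ℝ} (hf : 0 ≤ f) :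
    P {ω | ∃ t, K < t ∧ t ≤ T ∧ confWidth f (pulls I t i ω) (pulls I t j ω) ≤
        (empMean I X t i ω - armMean ν i) - (empMean I X t j ω - armMean ν j)}
      ≤ ENNReal.ofReal ((T : ℝ) ^ 2 / 2 * Real.exp (-f)) := by
  -- a pair `⟨m, a⟩` stands for `a` pulls of `i` and `m - a` pulls of `j`
  let S : (Σ _ : ℕ, ℕ) → Set Ω := fun p =>
    {ω | ∃ t, pulls I t i ω = p.2 ∧ pulls I t j ω = p.1 - p.2 ∧
      confWidth f p.2 (p.1 - p.2 : ℕ) ≤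
        (empMean I X t i ω - armMean ν i) - (empMean I X t j ω - armMean ν j)}
  have hcover : {ω | ∃ t, K < t ∧ t ≤ T ∧ confWidth f (pulls I t i ω) (pulls I t j ω) ≤
        (empMean I X t i ω - armMean ν i) - (empMean I X t j ω - armMean ν j)}
      ⊆ ⋃ p ∈ (Finset.range T).sigma fun m => Finset.Ico 1 m, S p := by
    rintro ω ⟨t, hKt, htT, hdev⟩
    have hsum := pulls_add_pulls_lt I hij (by omega : 1 ≤ t) ω
    have hi := one_le_pulls (hinit ω i) hKt
    have hj := one_le_pulls (hinit ω j) hKt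
    refine Set.mem_iUnion₂.2 ⟨⟨pulls I t i ω + pulls I t j ω, pulls I t i ω⟩, ?_, t, rfl, ?_⟩
    · simp only [Finset.mem_sigma, Finset.mem_range, Finset.mem_Ico]
      omega
    · simp only [Nat.add_sub_cancel_left]
      exact ⟨trivial, hdev⟩
  have hS : ∀ p ∈ (Finset.range T).sigma fun m => Finset.Ico 1 m,
      P (S p) ≤ ENNReal.ofReal (Real.exp (-f)) := fun p hp => by
    have hp2 := Finset.mem_Ico.1 (Finset.mem_sigma.1 hp).2
    exact h.measure_empMean_sub_le hsub hij hp2.1 (by omega) hf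
  refine (measure_mono hcover).trans ((measure_biUnion_finset_le_card_mul hS).trans ?_)
  have hcard : (2 * ((Finset.range T).sigma fun m => Finset.Ico 1 m).card : ℝ) ≤ (T : ℝ) ^ 2 := by
    exact_mod_cast two_mul_card_sigma_Ico_le T
  gcongr
  linarith

theorem measure_compl_isConcentrated_le (h : IsBanditRun P ν I X)
    (hinit : ∀ ω k, ∃ t ∈ Finset.Icc 1 K, I t ω = k) (hsub : ∀ k, IsOneSubGaussian (ν k))
    (T : ℕ) {f : ℝ} (hf : 0 ≤ f) {σ y : Fin K → ℝ} (hσ : ∀ k, σ k ^ 2 = 1) (hy : ∀ k, 0 < y k)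
    (hyT : ∀ k, 1 + 1 / (y k ^ 2 / 2) ≤ (T : ℝ) ^ 2) :
    P {ω | IsConcentrated (armMean ν) I X T f σ y ω}ᶜ
      ≤ ENNReal.ofReal ((K : ℝ) * (K + 1) / 2 * (T : ℝ) ^ 2 * Real.exp (-f)) := by
  let diffFails : Fin K × Fin K → Set Ω := fun p =>
    {ω | ∃ t, K < t ∧ t ≤ T ∧ confWidth f (pulls I t p.1 ω) (pulls I t p.2 ω) ≤
        (empMean I X t p.1 ω - armMean ν p.1) - (empMean I X t p.2 ω - armMean ν p.2)}
  let meanFails : Fin K → Set Ω := fun k =>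
    {ω | ∃ t, f ≤ pulls I t k ω * (y k ^ 2 / 2) ∧ y k ≤ σ k * (empMean I X t k ω - armMean ν k)}
  have hcover : {ω | IsConcentrated (armMean ν) I X T f σ y ω}ᶜ
      ⊆ (⋃ p ∈ (Finset.univ : Finset (Fin K)).offDiag, diffFails p)
        ∪ ⋃ k ∈ (Finset.univ : Finset (Fin K)), meanFails k := by
    intro ω hω
    by_contra hnot
    simp only [Set.mem_union, Set.mem_iUnion₂, not_or, not_exists] at hnot
    refine hω ⟨fun t hKt htT i j hij => lt_of_not_ge fun hle => ?_,
      fun k t hk => lt_of_not_ge fun hle => ?_⟩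
    · exact hnot.1 (i, j) (by simp [hij]) ⟨t, hKt, htT, hle⟩
    · exact hnot.2 k (Finset.mem_univ k) ⟨t, hk, hle⟩
  have hdiff := measure_biUnion_finset_le_card_mul (P := P) (S := diffFails)
    (s := Finset.univ.offDiag) fun p hp =>
    h.measure_forall_empMean_sub_le hinit hsub (Finset.mem_offDiag.1 hp).2.2 T hf
  have hmean := measure_biUnion_finset_le_card_mul (P := P) (s := Finset.univ) (S := meanFails)
    fun k _ => (h.measure_forall_mul_empMean_sub_le hsub k (hσ k) (hy k) f).trans
      (ENNReal.ofReal_le_ofReal (mul_le_mul_of_nonneg_right (hyT k) (Real.exp_pos _).le))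
  refine (measure_mono hcover).trans ((measure_union_le _ _).trans
    ((add_le_add hdiff hmean).trans_eq ?_))
  rw [← ENNReal.ofReal_add (by positivity) (by positivity), Finset.offDiag_card, Finset.card_univ,
    Fintype.card_fin, Nat.cast_sub (Nat.le_mul_self K)]
  congr 1
  push_cast
  ring

end IsBanditRun

/-! ### One round of the algorithm -/

theorem confWidth_mul_lt_one {f M x y : ℝ} (hf : 0 < f) (hM : 0 < M)
    (hx : 4 * f * M ^ 2 < x) (hy : 4 * f * M ^ 2 < y) : confWidth f x y * M < 1 := by
  have hpos : 0 < 4 * f * M ^ 2 := by positivity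
  have hx0 := hpos.trans hx
  have hy0 := hpos.trans hy
  have hinv : 1 / x + 1 / y < 2 / (4 * f * M ^ 2) := by
    have hx_inv := one_div_lt_one_div_of_lt hpos hx
    have hy_inv := one_div_lt_one_div_of_lt hpos hy
    rw [← one_add_one_eq_two, add_div]
    linarith
  refine lt_of_pow_lt_pow_left₀ 2 zero_le_one ?_
  rw [confWidth, mul_pow, mul_pow, Real.sq_sqrt (by positivity), Real.sq_sqrt (by positivity)]
  calc 2 * f * (1 / x + 1 / y) * M ^ 2 < 2 * f * (2 / (4 * f * M ^ 2)) * M ^ 2 := by gcongr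
    _ = 1 ^ 2 := by
      field_simp
      norm_num

theorem sqrt_le_confWidth_mul_sqrt (f : ℝ) {x y : ℝ} (hx : 0 ≤ x) (hy : 0 < y) :
    Real.sqrt (2 * f) ≤ confWidth f x y * Real.sqrt y := by
  have hone : 1 ≤ Real.sqrt (1 / x + 1 / y) * Real.sqrt y := by
    rw [← Real.sqrt_mul (by positivity), Real.one_le_sqrt, add_mul, one_div_mul_cancel hy.ne']
    exact le_add_of_nonneg_left (by positivity)
  rw [confWidth, mul_assoc]
  exact le_mul_of_one_le_right (Real.sqrt_nonneg _) hone

namespace IsEBTCRun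

variable {Ω : Type*} {K : ℕ} [MeasurableSpace Ω] {P : Measure Ω} {ν : Fin K → Measure ℝ}
  {ε₀ β : ℝ} {ihat C I : ℕ → Ω → Fin K} {X : ℕ → Ω → ℝ}

theorem slack_mul_confWidth_lt (h : IsEBTCRun P ν ε₀ β ihat C I X) (hε₀ : 0 < ε₀) {f M : ℝ}
    (hf : 0 < f) (hM : 0 < M) {t : ℕ} (hKt : K < t) {ω : Ω}
    (hleader : 4 * f * M ^ 2 < pulls I t (ihat t ω) ω)
    (hchallenger : 4 * f * M ^ 2 < pulls I t (C t ω) ω) {k : Fin K} (hk : k ≠ ihat t ω) :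
    ε₀ * M * confWidth f (pulls I t (ihat t ω) ω) (pulls I t k ω)
      < empMean I X t (ihat t ω) ω - empMean I X t k ω + ε₀ := by
  have hmax := h.ihat_max ω t hKt (C t ω)
  have hmin := h.challenger_min ω t hKt k hk
  have hwidth := confWidth_mul_lt_one hf hM hleader hchallenger
  have hpulls (k' : Fin K) : (0 : ℝ) < pulls I t k' ω := by
    exact_mod_cast one_le_pulls (h.init ω k') hKt
  have hsqrt (k' : Fin K) :
      0 < Real.sqrt (1 / (pulls I t (ihat t ω) ω : ℝ) + 1 / (pulls I t k' ω : ℝ)) :=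
    Real.sqrt_pos.2 (add_pos (one_div_pos.2 (hpulls _)) (one_div_pos.2 (hpulls _)))
  rw [confWidth] at hwidth ⊢
  rw [← mul_assoc, ← lt_div_iff₀ (hsqrt k)]
  calc ε₀ * M * Real.sqrt (2 * f)
      < ε₀ / Real.sqrt (1 / (pulls I t (ihat t ω) ω : ℝ) + 1 / (pulls I t (C t ω) ω : ℝ)) := by
        rw [lt_div_iff₀ (hsqrt _)]
        linarith [mul_lt_mul_of_pos_left hwidth hε₀]
    _ ≤ transportCost ε₀ I X t (ihat t ω) (C t ω) ω :=
        div_le_div_of_nonneg_right (by linarith) (hsqrt _).le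
    _ ≤ transportCost ε₀ I X t (ihat t ω) k ω := hmin

/-- If leader and challenger were both well sampled, the cost of a best arm `k` against the leader
would be large; as `k` is not empirically best, the leader would then be good. -/
theorem pulls_leader_le_or_pulls_challenger_le (h : IsEBTCRun P ν ε₀ β ihat C I X) (hε₀ : 0 < ε₀)
    {μ : Fin K → ℝ} {f : ℝ} (hf : 0 < f) {t : ℕ} (hKt : K < t) {ω : Ω}
    (hω : HasAccurateDiffs μ I X f t ω) {Δ : ℝ} (hΔ : 0 < Δ)
    (hgap : Δ ≤ maxMean μ - μ (ihat t ω)) {d : Fin K → ℝ}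
    (hd_best : ∀ k, μ k = maxMean μ → Δ⁻¹ ≤ d k)
    (hd : ∀ k, μ k ≠ maxMean μ → max Δ⁻¹ ε₀⁻¹ ≤ d k) :
    (pulls I t (ihat t ω) ω : ℝ) ≤ 4 * f * d (ihat t ω) ^ 2 ∨
      (pulls I t (C t ω) ω : ℝ) ≤ 4 * f * d (C t ω) ^ 2 := by
  by_contra! hcon
  obtain ⟨hleader, hchallenger⟩ := hcon
  have hΔ_inv : 0 < Δ⁻¹ := inv_pos.2 hΔ
  have hleader_ne : μ (ihat t ω) ≠ maxMean μ := fun heq => by linarith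
  have hsampled {k : Fin K} {M : ℝ} (hM : 0 < M) (hMd : M ≤ d k)
      (hk : 4 * f * d k ^ 2 < pulls I t k ω) : 4 * f * M ^ 2 < pulls I t k ω :=
    lt_of_le_of_lt (by gcongr) hk
  by_cases hbest : μ (C t ω) = maxMean μ
  · have hwidth := confWidth_mul_lt_one hf hΔ_inv
      (hsampled hΔ_inv ((le_max_left _ _).trans (hd _ hleader_ne)) hleader)
      (hsampled hΔ_inv (hd_best _ hbest) hchallenger)
    rw [← div_eq_mul_inv, div_lt_one hΔ] at hwidth
    linarith [hω _ _ (h.challenger_ne ω t hKt).symm, h.ihat_max ω t hKt (C t ω)]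
  · set M := max Δ⁻¹ ε₀⁻¹
    have hM : 0 < M := hΔ_inv.trans_le (le_max_left _ _)
    obtain ⟨k, hk⟩ := exists_eq_maxMean (Fin.pos (ihat t ω)) μ
    have hne : k ≠ ihat t ω := fun heq => hleader_ne (heq ▸ hk)
    set w := confWidth f (pulls I t (ihat t ω) ω) (pulls I t k ω)
    set g := maxMean μ - μ (ihat t ω)
    have hcost : ε₀ * M * w < empMean I X t (ihat t ω) ω - empMean I X t k ω + ε₀ :=
      h.slack_mul_confWidth_lt hε₀ hf hM hKt (hsampled hM (hd _ hleader_ne) hleader)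
        (hsampled hM (hd _ hbest) hchallenger) hne
    have hdiff : empMean I X t (ihat t ω) ω - empMean I X t k ω + g < w := by
      linarith [hω _ _ hne.symm]
    have hgw : g < w := by linarith [h.ihat_max ω t hKt k]
    have hM_slack : 1 ≤ M * ε₀ := (inv_le_iff_one_le_mul₀ hε₀).1 (le_max_right _ _)
    have hM_gap : 1 ≤ M * g :=
      (inv_le_iff_one_le_mul₀ (hΔ.trans_le hgap)).1
        ((inv_anti₀ hΔ hgap).trans (le_max_left _ _))
    linarith [mul_le_mul_of_nonneg_right hgw.le (sub_nonneg.2 hM_slack),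
      mul_le_mul_of_nonneg_right hM_gap hε₀.le]

/-- The multiplier `c` is chosen such that `2 (g + ε₀) / (g - Δ₁) ≤ ε₀ c - 1` for all gaps
`g ≥ Δ₂`. -/
theorem le_pulls_mul_sq (h : IsEBTCRun P ν ε₀ β ihat C I X) (hε₀ : 0 < ε₀) {μ : Fin K → ℝ}
    {f : ℝ} (hf : 0 < f) {t : ℕ} (hKt : K < t) {ω : Ω} (hω : HasAccurateDiffs μ I X f t ω)
    {Δ₁ Δ₂ c : ℝ} (hΔ₁ : 0 ≤ Δ₁) (hΔ : Δ₁ < Δ₂) (hlead : maxMean μ - μ (ihat t ω) ≤ Δ₁)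
    (hc : c = 2 * ((Δ₁ / ε₀ + 1) / (Δ₂ - Δ₁)) + 3 * ε₀⁻¹)
    (hleader : 4 * f * c ^ 2 < pulls I t (ihat t ω) ω)
    (hchallenger : 4 * f * c ^ 2 < pulls I t (C t ω) ω)
    {k : Fin K} (hk : Δ₂ ≤ maxMean μ - μ k) :
    f ≤ pulls I t k ω * (((maxMean μ - μ k - Δ₁) / 2) ^ 2 / 2) := by
  have hne : k ≠ ihat t ω := by
    rintro rfl
    linarith
  have hpulls : (0 : ℝ) < pulls I t k ω := by exact_mod_cast one_le_pulls (h.init ω k) hKt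
  have hsep : 0 < Δ₂ - Δ₁ := sub_pos.2 hΔ
  have hc0 : 0 < c := by
    rw [hc]
    positivity
  set g := maxMean μ - μ k
  have hg : 0 < g - Δ₁ := by linarith
  have hgε : 0 < g + ε₀ := by linarith
  set w := confWidth f (pulls I t (ihat t ω) ω) (pulls I t k ω)
  set q := Real.sqrt (pulls I t k ω)
  have hcost : (ε₀ * c - 1) * w < g + ε₀ := by
    have hslack := h.slack_mul_confWidth_lt hε₀ hf hc0 hKt hleader hchallenger hne
    linarith [hω _ _ hne.symm, le_maxMean μ (ihat t ω)]
  have hmultiplier : 2 * (g + ε₀) / (g - Δ₁) ≤ ε₀ * c - 1 := by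
    calc 2 * (g + ε₀) / (g - Δ₁) = 2 * (Δ₁ + ε₀) / (g - Δ₁) + 2 := by
          field_simp
          ring
      _ ≤ 2 * (Δ₁ + ε₀) / (Δ₂ - Δ₁) + 2 := by gcongr
      _ = ε₀ * c - 1 := by
          rw [hc]
          field_simp
          ring
  have hw_lt : 2 * w < g - Δ₁ := by
    have hle : 2 * (g + ε₀) / (g - Δ₁) * w ≤ (ε₀ * c - 1) * w :=
      mul_le_mul_of_nonneg_right hmultiplier (by unfold w confWidth; positivity)
    have hlt := hle.trans_lt hcost
    rw [div_mul_eq_mul_div, div_lt_iff₀ hg] at hlt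
    refine lt_of_mul_lt_mul_left ?_ hgε.le
    linarith
  have hwq : Real.sqrt (2 * f) ≤ w * q := sqrt_le_confWidth_mul_sqrt f (Nat.cast_nonneg _) hpulls
  have hsqrt : Real.sqrt (2 * f) ≤ q * ((g - Δ₁) / 2) := by
    have := mul_le_mul_of_nonneg_right hw_lt.le (Real.sqrt_nonneg (pulls I t k ω : ℝ))
    linarith
  have hsq := pow_le_pow_left₀ (Real.sqrt_nonneg _) hsqrt 2
  rw [mul_pow, Real.sq_sqrt (by positivity), Real.sq_sqrt hpulls.le] at hsq
  linarith

end IsEBTCRun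

/-! ### The Lambert function -/

theorem strictMonoOn_sub_log : StrictMonoOn (fun y : ℝ => y - Real.log y) (Set.Ici 1) := by
  intro y hy z hz hyz
  rw [Set.mem_Ici] at hy hz
  have hlog : Real.log (z / y) < z / y - 1 :=
    Real.log_lt_sub_one_of_pos (by positivity) ((one_lt_div (by linarith)).2 hyz).ne'
  have hratio : z / y - 1 ≤ z - y := by
    rw [div_sub_one (by linarith)]
    exact div_le_self (by linarith) hy
  rw [Real.log_div (by linarith) (by linarith)] at hlog
  change y - Real.log y < z - Real.log z
  linarith

theorem exists_sub_log_eq {x : ℝ} (hx : 1 ≤ x) : ∃ y, 1 ≤ y ∧ y - Real.log y = x := by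
  have hcont : ContinuousOn (fun y : ℝ => y - Real.log y) (Set.Icc 1 (2 * x)) :=
    continuousOn_id.sub (Real.continuousOn_log.mono fun y hy => by
      have : (0 : ℝ) < y := one_pos.trans_le hy.1
      exact this.ne')
  have hright : x ≤ 2 * x - Real.log (2 * x) := by
    have hlog := Real.log_le_sub_one_of_pos (by linarith : (0 : ℝ) < x)
    rw [Real.log_mul two_ne_zero (by linarith)]
    linarith [Real.log_two_lt_d9]
  obtain ⟨y, hy, hyx⟩ := intermediate_value_Icc (by linarith : (1 : ℝ) ≤ 2 * x) hcont
    (show x ∈ Set.Icc _ _ from ⟨by simpa using hx, hright⟩)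
  exact ⟨y, hy.1, hyx⟩

theorem exists_mul_exp_eq {x : ℝ} (hx : 1 ≤ x) :
    ∃ w ∈ Set.Iic (-1 : ℝ), w * Real.exp w = - Real.exp (-x) := by
  obtain ⟨y, hy, hyx⟩ := exists_sub_log_eq hx
  refine ⟨-y, neg_le_neg hy, ?_⟩
  rw [neg_mul, ← hyx, neg_sub, sub_eq_add_neg, Real.exp_add, Real.exp_log (by linarith)]

theorem one_le_lambertWBar {x : ℝ} (hx : 1 ≤ x) : 1 ≤ lambertWBar x :=
  le_neg.1 (Function.invFunOn_mem (exists_mul_exp_eq hx))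

theorem lambertWBar_sub_log {x : ℝ} (hx : 1 ≤ x) :
    lambertWBar x - Real.log (lambertWBar x) = x := by
  have hW := one_le_lambertWBar hx
  have heq : lambertWNegOne (- Real.exp (-x)) * Real.exp (lambertWNegOne (- Real.exp (-x)))
      = - Real.exp (-x) := Function.invFunOn_eq (exists_mul_exp_eq hx)
  have heq' : lambertWBar x * Real.exp (- lambertWBar x) = Real.exp (-x) := by
    rw [lambertWBar, neg_neg, neg_mul, heq, neg_neg]
  have hlog := congrArg Real.log heq'
  rw [Real.log_mul (by linarith) (Real.exp_pos _).ne', Real.log_exp, Real.log_exp] at hlog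
  linarith

theorem lambertWBar_le {x : ℝ} (hx : 1 ≤ x) : lambertWBar x ≤ 2 * x := by
  have hW := one_le_lambertWBar hx
  have hlog := Real.log_le_sub_one_of_pos (by linarith : (0 : ℝ) < lambertWBar x / 2)
  rw [Real.log_div (by linarith) two_ne_zero] at hlog
  linarith [lambertWBar_sub_log hx, Real.log_two_lt_d9]

theorem hTwo_eq {L A B : ℝ} (hA : 0 < A)
    (harg : 1 ≤ 1 / 2 * L + B / (2 * A) + Real.log (2 * A)) :
    hTwo L A B = A * L + (B + 2 * A * Real.log (2 * A)) + 2 * A * Real.log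
      (lambertWBar (1 / 2 * L + B / (2 * A) + Real.log (2 * A))) := by
  have hspec := lambertWBar_sub_log harg
  rw [hTwo]
  set y := lambertWBar (1 / 2 * L + B / (2 * A) + Real.log (2 * A))
  calc 2 * A * y = 2 * A * (1 / 2 * L + B / (2 * A) + Real.log (2 * A) + Real.log y) := by
        rw [← hspec, sub_add_cancel]
    _ = _ := by
        field_simp
        ring

/-- `hTwo L A B` solves `x = A L + B + 2 A log x`. -/
theorem lt_of_hTwo_lt {L A B x : ℝ} (hA : 0 < A)
    (harg : 1 ≤ 1 / 2 * L + B / (2 * A) + Real.log (2 * A)) (hx : hTwo L A B < x) :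
    A * L + B + 2 * A * Real.log x < x := by
  have hy := one_le_lambertWBar harg
  have hfixed := hTwo_eq hA harg
  rw [hTwo] at hx hfixed
  set y := lambertWBar (1 / 2 * L + B / (2 * A) + Real.log (2 * A))
  obtain ⟨z, rfl⟩ : ∃ z, x = 2 * A * z := ⟨x / (2 * A), by field_simp⟩
  have hyz : y < z := lt_of_mul_lt_mul_left hx (by positivity)
  have hmono : y - Real.log y < z - Real.log z :=
    strictMonoOn_sub_log hy (hy.trans hyz.le) hyz
  rw [Real.log_mul (by positivity) (by linarith)]
  linarith [mul_lt_mul_of_pos_left hmono (by positivity : 0 < 2 * A)]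

theorem log_lambertWBar_le {L x : ℝ} (hx : 1 ≤ x) (hxL : x ≤ L) (hL : 2 ≤ L) :
    Real.log (lambertWBar x) ≤ 2 * Real.log L := by
  calc Real.log (lambertWBar x) ≤ Real.log (L ^ 2) :=
        Real.log_le_log (one_pos.trans_le (one_le_lambertWBar hx))
          (by nlinarith [lambertWBar_le hx])
    _ = 2 * Real.log L := by rw [Real.log_pow, Nat.cast_ofNat]

theorem abs_hTwo_sub_le {L A B : ℝ} (hA : 0 < A)
    (hL : |B / A + 2 * Real.log (2 * A)| + 3 ≤ L) :
    |hTwo L A B - A * L| ≤ (|B + 2 * A * Real.log (2 * A)| + 4 * A) * Real.log L := by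
  have harg_eq : 1 / 2 * L + B / (2 * A) + Real.log (2 * A)
      = (L + (B / A + 2 * Real.log (2 * A))) / 2 := by
    field_simp
    ring
  obtain ⟨hneg, hpos⟩ := abs_le.1 (le_refl |B / A + 2 * Real.log (2 * A)|)
  have harg : 1 ≤ 1 / 2 * L + B / (2 * A) + Real.log (2 * A) := by linarith
  have : 3 ≤ L := by linarith [abs_nonneg (B / A + 2 * Real.log (2 * A))]
  have hlogL : 1 ≤ Real.log L := by
    rw [Real.le_log_iff_exp_le (by linarith)]
    linarith [Real.exp_one_lt_d9]
  have hlogW := log_lambertWBar_le harg (by linarith) (by linarith : 2 ≤ L)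
  have hlogW_nonneg := Real.log_nonneg (one_le_lambertWBar harg)
  rw [hTwo_eq hA harg]
  set w := Real.log (lambertWBar (1 / 2 * L + B / (2 * A) + Real.log (2 * A)))
  calc |A * L + (B + 2 * A * Real.log (2 * A)) + 2 * A * w - A * L|
      = |(B + 2 * A * Real.log (2 * A)) + 2 * A * w| := by ring_nf
    _ ≤ |B + 2 * A * Real.log (2 * A)| + |2 * A * w| := abs_add_le _ _
    _ = |B + 2 * A * Real.log (2 * A)| + 2 * A * w := by
        rw [abs_of_nonneg (by positivity : 0 ≤ 2 * A * w)]
    _ ≤ |B + 2 * A * Real.log (2 * A)| * Real.log L + 2 * A * (2 * Real.log L) := by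
        gcongr
        exact le_mul_of_one_le_right (abs_nonneg _) hlogL
    _ = _ := by ring

theorem hTwo_sub_isBigO (A B : ℝ) (hA : 0 < A) :
    (fun δ : ℝ => hTwo (Real.log (1 / δ)) A B - A * Real.log (1 / δ))
      =O[𝓝[>] 0] fun δ : ℝ => Real.log (Real.log (1 / δ)) := by
  have hlog : Tendsto (fun δ : ℝ => Real.log (1 / δ)) (𝓝[>] 0) atTop := by
    simp_rw [one_div]
    exact Real.tendsto_log_atTop.comp tendsto_inv_nhdsGT_zero
  refine IsBigO.of_bound (|B + 2 * A * Real.log (2 * A)| + 4 * A) ?_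
  filter_upwards [hlog.eventually_ge_atTop (|B / A + 2 * Real.log (2 * A)| + 3)] with δ hδ
  rw [Real.norm_eq_abs, Real.norm_eq_abs]
  exact (abs_hTwo_sub_le hA hδ).trans (mul_le_mul_of_nonneg_left (le_abs_self _) (by positivity))

/-! ### Recommendations under concentration -/

namespace IsEBTCRun

variable {Ω : Type*} {K : ℕ} [MeasurableSpace Ω] {P : Measure Ω} {ν : Fin K → Measure ℝ}
  {ε₀ β : ℝ} {ihat C I : ℕ → Ω → Fin K} {X : ℕ → Ω → ℝ} {μ : Fin K → ℝ} {i j T : ℕ} {f : ℝ} {ω : Ω}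

theorem pulls_le_or_pulls_le_of_lt_gapIndex (h : IsEBTCRun P ν ε₀ β ihat C I X) (hε₀ : 0 < ε₀)
    (hj : 1 ≤ j) (hjn : j < numClasses μ) (hf : 0 < f) {t : ℕ} (hKt : K < t)
    (hω : HasAccurateDiffs μ I X f t ω) {d : ℕ → ℝ} (hd_one : (sortedGap μ (j + 1))⁻¹ ≤ d 1)
    (hd : ∀ m, m ≠ 1 → max (sortedGap μ (j + 1))⁻¹ ε₀⁻¹ ≤ d m)
    (hlead : j < gapIndex μ (ihat t ω)) :
    (pulls I t (ihat t ω) ω : ℝ) ≤ 4 * f * d (gapIndex μ (ihat t ω)) ^ 2 ∨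
      (pulls I t (C t ω) ω : ℝ) ≤ 4 * f * d (gapIndex μ (C t ω)) ^ 2 :=
  h.pulls_leader_le_or_pulls_challenger_le hε₀ hf hKt hω (sortedGap_pos (by omega) hjn)
    ((sortedGap_le_gap_iff ⟨by omega, hjn⟩).2 hlead) (d := fun k => d (gapIndex μ k))
    (fun k hk => by rwa [gapIndex_eq_one_iff.2 hk])
    (fun k hk => hd _ (mt gapIndex_eq_one_iff.1 hk))

theorem le_pulls_mul_sq_of_lt_gapIndex (h : IsEBTCRun P ν ε₀ (1 / 2) ihat C I X) (hε₀ : 0 < ε₀)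
    (hj : 1 ≤ j) (hji : j ≤ i) (hi : i < numClasses μ) (hf : 0 < f)
    (hT : 8 * hBar μ ε₀ i j * f + 5 * (K : ℝ) ^ 2 / 2 < T)
    (hω : ∀ t, K < t → t ≤ T → HasAccurateDiffs μ I X f t ω) {k : Fin K}
    (hk : i < gapIndex μ k) :
    f ≤ pulls I T k ω * (((maxMean μ - μ k - sortedGap μ j) / 2) ^ 2 / 2) := by
  have hjn : j ∈ Set.Icc 1 (numClasses μ) := ⟨hj, by omega⟩
  have hin : i + 1 ∈ Set.Icc 1 (numClasses μ) := ⟨by omega, hi⟩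
  obtain ⟨t, ht, -, hleader, hchallenger⟩ := (h.isHalfTracking ω).exists_leader_notMem_pulls_gt
    (T := T) (D := fun k => 4 * f * barTerm μ ε₀ i j (gapIndex μ k) ^ 2)
    (fun k => by positivity) ∅ (by
      rw [← Finset.mul_sum, sum_barTerm_sq μ ε₀ hj hji hi.le, Finset.sum_empty]
      linarith)
  obtain ⟨hKt, htT⟩ := Finset.mem_Ioo.1 ht
  have hlead : gapIndex μ (ihat t ω) ≤ j := by
    by_contra! hlt
    rcases h.pulls_le_or_pulls_le_of_lt_gapIndex hε₀ hj (by omega) hf hKt (hω t hKt htT.le)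
      (inv_le_barTerm_one ε₀ i (by omega)) (fun m hm => max_inv_le_barTerm hε₀ hj hji hi hm) hlt
      with hle | hle
    · exact hle.not_gt hleader
    · exact hle.not_gt hchallenger
  have hc : 0 < cTwo μ ε₀ (i + 1) j := (inv_pos.2 hε₀).trans_le (inv_le_cTwo hε₀ hj hji hi)
  have hbar (m : ℕ) : 4 * f * cTwo μ ε₀ (i + 1) j ^ 2 ≤ 4 * f * barTerm μ ε₀ i j m ^ 2 := by
    gcongr
    exact cTwo_le_barTerm μ ε₀ i j m
  have hpulls := h.le_pulls_mul_sq hε₀ hf hKt (hω t hKt htT.le) (sortedGap_nonneg hjn)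
    (strictMonoOn_sortedGap μ hjn hin (by omega)) ((gap_le_sortedGap_iff hjn).2 hlead) rfl
    ((hbar _).trans_lt hleader) ((hbar _).trans_lt hchallenger) ((sortedGap_le_gap_iff hin).2 hk)
  refine hpulls.trans ?_
  gcongr
  exact pulls_mono I k ω htT.le

/-- Otherwise, counting only the rounds whose leader lies outside the first `j` classes would still
leave one where leader and challenger are both well sampled. -/
theorem exists_gapIndex_le_le_pulls (h : IsEBTCRun P ν ε₀ (1 / 2) ihat C I X)
    (hj : 1 ≤ j) (hjn : j < numClasses μ) (hε₀ : 0 < ε₀) (hf : 0 < f)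
    (hT : 8 * hTilde μ ε₀ i j * f + 5 * (K : ℝ) ^ 2 / 2 < T)
    (hω : ∀ t, K < t → t ≤ T → HasAccurateDiffs μ I X f t ω) :
    ∃ k, gapIndex μ k ≤ j ∧
      8 * f / (sortedGap μ (i + 1) - sortedGap μ j) ^ 2 ≤ pulls I T k ω := by
  by_contra! hfew
  set G := Finset.univ.filter (fun k => gapIndex μ k ≤ j)
  set q := 8 * f / (sortedGap μ (i + 1) - sortedGap μ j) ^ 2
  have hG : ∑ k ∈ G, (pulls I T k ω : ℝ) ≤ G.card * q := by
    rw [← nsmul_eq_mul]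
    exact Finset.sum_le_card_nsmul _ _ _ fun k hk => (hfew k (Finset.mem_filter.1 hk).2).le
  obtain ⟨t, ht, hleadG, hleader, hchallenger⟩ :=
    (h.isHalfTracking ω).exists_leader_notMem_pulls_gt
      (T := T) (D := fun k => 4 * f * tildeTerm μ ε₀ j (gapIndex μ k) ^ 2)
      (fun k => by positivity) G (by
        have hsum : 2 * (4 * f * ∑ k, tildeTerm μ ε₀ j (gapIndex μ k) ^ 2) + 2 * (G.card * q)
            = 8 * hTilde μ ε₀ i j * f := by
          rw [← sum_tildeTerm_sq_add μ ε₀ i hj hjn.le]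
          ring
        rw [← Finset.mul_sum]
        linarith)
  obtain ⟨hKt, htT⟩ := Finset.mem_Ioo.1 ht
  rcases h.pulls_le_or_pulls_le_of_lt_gapIndex hε₀ hj hjn hf hKt (hω t hKt htT.le)
    (inv_le_tildeTerm_one ε₀ hjn) (fun m hm => max_inv_le_tildeTerm μ ε₀ j hm)
    (by simpa [G] using hleadG) with hle | hle
  · exact hle.not_gt hleader
  · exact hle.not_gt hchallenger

end IsEBTCRun

/-- The direction in which the empirical mean of an arm should not err: downwards for the arms of
the first `i` classes, upwards for the others. -/
noncomputable def errorSign {K : ℕ} (μ : Fin K → ℝ) (i : ℕ) (k : Fin K) : ℝ :=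
  if gapIndex μ k ≤ i then -1 else 1

/-- The admissible error of the empirical mean of an arm in the direction `errorSign`: half of its
distance to the means of class `j`, but at least half of the distance of the classes `j` and
`i + 1`. -/
noncomputable def errorMargin {K : ℕ} (μ : Fin K → ℝ) (i j : ℕ) (k : Fin K) : ℝ :=
  (max (maxMean μ - μ k) (sortedGap μ (i + 1)) - sortedGap μ j) / 2

section ErrorMargin

variable {K : ℕ} {μ : Fin K → ℝ} {i j : ℕ} {k : Fin K}

theorem errorSign_sq (μ : Fin K → ℝ) (i : ℕ) (k : Fin K) : errorSign μ i k ^ 2 = 1 := by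
  rw [errorSign]
  split_ifs <;> norm_num

theorem half_sub_le_errorMargin (μ : Fin K → ℝ) (i j : ℕ) (k : Fin K) :
    (sortedGap μ (i + 1) - sortedGap μ j) / 2 ≤ errorMargin μ i j k := by
  have := le_max_right (maxMean μ - μ k) (sortedGap μ (i + 1))
  rw [errorMargin]
  linarith

theorem errorMargin_of_gapIndex_le (hi : i < numClasses μ) (hk : gapIndex μ k ≤ i) :
    errorMargin μ i j k = (sortedGap μ (i + 1) - sortedGap μ j) / 2 := by
  rw [errorMargin, max_eq_right ((gap_le_sortedGap_iff ⟨by omega, hi⟩).2 (by omega))]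

theorem errorMargin_of_lt_gapIndex (hk : i < gapIndex μ k) :
    errorMargin μ i j k = (maxMean μ - μ k - sortedGap μ j) / 2 := by
  have hkn := (gapIndex_mem μ k).2
  rw [errorMargin, max_eq_left ((sortedGap_le_gap_iff ⟨by omega, by omega⟩).2 hk)]

theorem one_add_one_div_errorMargin_sq_le {ε₀ : ℝ} (hj : 1 ≤ j) (hji : j ≤ i)
    (hi : i < numClasses μ) {T : ℕ} (hT : 1 + 4 * hTilde μ ε₀ i j ≤ T) (k : Fin K) :
    1 + 1 / (errorMargin μ i j k ^ 2 / 2) ≤ (T : ℝ) ^ 2 := by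
  have hsep : 0 < sortedGap μ (i + 1) - sortedGap μ j :=
    sub_pos.2 (strictMonoOn_sortedGap μ ⟨hj, by omega⟩ ⟨by omega, hi⟩ (by omega))
  calc 1 + 1 / (errorMargin μ i j k ^ 2 / 2)
      ≤ 1 + 1 / (((sortedGap μ (i + 1) - sortedGap μ j) / 2) ^ 2 / 2) := by
        gcongr
        exact half_sub_le_errorMargin μ i j k
    _ = 1 + 4 * (2 / (sortedGap μ (i + 1) - sortedGap μ j) ^ 2) := by
        field_simp
        norm_num
    _ ≤ 1 + 4 * hTilde μ ε₀ i j := by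
        gcongr
        exact two_div_sq_le_hTilde ε₀ i hj (by omega)
    _ ≤ T := hT
    _ ≤ (T : ℝ) ^ 2 := by exact_mod_cast Nat.le_self_pow two_ne_zero T

end ErrorMargin

namespace IsEBTCRun

variable {Ω : Type*} {K : ℕ} [MeasurableSpace Ω] {P : Measure Ω} {ν : Fin K → Measure ℝ}
  {ε₀ : ℝ} {ihat C I : ℕ → Ω → Fin K} {X : ℕ → Ω → ℝ}

theorem gapIndex_ihat_le (h : IsEBTCRun P ν ε₀ (1 / 2) ihat C I X) (hε₀ : 0 < ε₀)
    {μ : Fin K → ℝ} {i j : ℕ} (hj : 1 ≤ j) (hji : j ≤ i) (hi : i < numClasses μ) {T : ℕ}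
    (hKT : K < T) {f : ℝ} (hf : 0 < f)
    (hT : 8 * max (hBar μ ε₀ i j) (hTilde μ ε₀ i j) * f + 5 * (K : ℝ) ^ 2 / 2 < T) {ω : Ω}
    (hω : IsConcentrated μ I X T f (errorSign μ i) (errorMargin μ i j) ω) {n : ℕ} (hn : T ≤ n) :
    gapIndex μ (ihat n ω) ≤ i := by
  by_contra! hbad
  have hjn : j ∈ Set.Icc 1 (numClasses μ) := ⟨hj, by omega⟩
  have hsep : 0 < sortedGap μ (i + 1) - sortedGap μ j :=
    sub_pos.2 (strictMonoOn_sortedGap μ hjn ⟨by omega, hi⟩ (by omega))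
  have hbound {H : ℝ} (hH : H ≤ max (hBar μ ε₀ i j) (hTilde μ ε₀ i j)) :
      8 * H * f + 5 * (K : ℝ) ^ 2 / 2 < T := lt_of_le_of_lt (by gcongr) hT
  have hpulls (k : Fin K) : (pulls I T k ω : ℝ) ≤ pulls I n k ω := by
    exact_mod_cast pulls_mono I k ω hn
  have hbad_err : empMean I X n (ihat n ω) ω - μ (ihat n ω)
      < (maxMean μ - μ (ihat n ω) - sortedGap μ j) / 2 := by
    have hmany := h.le_pulls_mul_sq_of_lt_gapIndex hε₀ hj hji hi hf (hbound (le_max_left _ _))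
      hω.1 hbad
    have herr := hω.2 (ihat n ω) n (by
      rw [errorMargin_of_lt_gapIndex hbad]
      exact hmany.trans (mul_le_mul_of_nonneg_right (hpulls _) (by positivity)))
    rwa [errorSign, if_neg hbad.not_ge, one_mul, errorMargin_of_lt_gapIndex hbad] at herr
  obtain ⟨k, hkj, hmany⟩ := h.exists_gapIndex_le_le_pulls (i := i) hj (by omega) hε₀ hf
    (hbound (le_max_right _ _)) hω.1
  have hgood_err : μ k - empMean I X n k ω < (sortedGap μ (i + 1) - sortedGap μ j) / 2 := by
    have herr := hω.2 k n (by
      rw [errorMargin_of_gapIndex_le hi (hkj.trans hji)]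
      rw [div_le_iff₀ (by positivity)] at hmany
      linarith [mul_le_mul_of_nonneg_right (hpulls k)
        (sq_nonneg (sortedGap μ (i + 1) - sortedGap μ j))])
    rw [errorSign, if_pos (hkj.trans hji), errorMargin_of_gapIndex_le hi (hkj.trans hji)] at herr
    linarith
  have hbad_gap := (sortedGap_le_gap_iff ⟨by omega, hi⟩).2 hbad
  have hgood_gap := (gap_le_sortedGap_iff hjn).2 hkj
  linarith [h.ihat_max ω n (hKT.trans_le hn) k]

end IsEBTCRun

/-! ### The sample complexity -/

section SampleComplexity

variable {Ω : Type*} {K : ℕ}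

/-- The level `f` such that a union bound over `K (K + 1) / 2 * T ^ 2` events of probability
`e^{-f}` costs `δ`. -/
noncomputable def confidenceLevel (K T : ℕ) (δ : ℝ) : ℝ :=
  Real.log (1 / δ) + Real.log ((K : ℝ) * ((K : ℝ) + 1) / 2) + 2 * Real.log T

theorem mul_exp_neg_confidenceLevel {K T : ℕ} (hK : 0 < K) (hT : 0 < T) {δ : ℝ} (hδ : 0 < δ) :
    (K : ℝ) * (K + 1) / 2 * (T : ℝ) ^ 2 * Real.exp (-confidenceLevel K T δ) = δ := by
  have hlog : confidenceLevel K T δ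
      = Real.log (1 / δ * ((K : ℝ) * ((K : ℝ) + 1) / 2) * (T : ℝ) ^ 2) := by
    rw [Real.log_mul (by positivity) (by positivity), Real.log_mul (by positivity) (by positivity),
      Real.log_pow, confidenceLevel, Nat.cast_ofNat]
  rw [hlog, Real.exp_neg, Real.exp_log (by positivity)]
  field_simp

theorem one_le_confidenceLevel (hK : 2 ≤ K) (T : ℕ) {δ : ℝ} (hδ : 0 < δ) (hδ1 : δ < 1) :
    1 ≤ confidenceLevel K T δ := by
  have hK' : (2 : ℝ) ≤ K := by exact_mod_cast hK
  have hlogK : 1 ≤ Real.log ((K : ℝ) * ((K : ℝ) + 1) / 2) := by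
    rw [Real.le_log_iff_exp_le (by positivity)]
    nlinarith [Real.exp_one_lt_three]
  rw [confidenceLevel]
  linarith [Real.log_nonneg (one_le_one_div hδ hδ1.le), Real.log_natCast_nonneg T]

theorem one_le_arg_hTwo {L A : ℝ} (hK : 2 ≤ K) (hL : 0 ≤ L) (hA : 0 < A) :
    1 ≤ 1 / 2 * L + (A * Real.log ((K : ℝ) * ((K : ℝ) + 1) / 2) + 5 * (K : ℝ) ^ 2 / 2) / (2 * A)
      + Real.log (2 * A) := by
  have hK' : (2 : ℝ) ≤ K := by exact_mod_cast hK
  have hlogK : 0 ≤ Real.log ((K : ℝ) * ((K : ℝ) + 1) / 2) := Real.log_nonneg (by nlinarith)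
  have hlogA := Real.one_sub_inv_le_log_of_pos (by positivity : 0 < 2 * A)
  have hsplit : (A * Real.log ((K : ℝ) * ((K : ℝ) + 1) / 2) + 5 * (K : ℝ) ^ 2 / 2) / (2 * A)
      = Real.log ((K : ℝ) * ((K : ℝ) + 1) / 2) / 2 + 5 * (K : ℝ) ^ 2 / 2 * (2 * A)⁻¹ := by
    field_simp
  have hinv : (2 * A)⁻¹ ≤ 5 * (K : ℝ) ^ 2 / 2 * (2 * A)⁻¹ :=
    le_mul_of_one_le_left (by positivity) (by nlinarith)
  linarith

theorem complexityH_mul_confidenceLevel_lt (hK : 2 ≤ K) {μ : Fin K → ℝ} {ε₀ : ℝ} (hε₀ : 0 < ε₀)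
    {i : ℕ} (hi : 1 ≤ i) (hin : i < numClasses μ) {δ : ℝ} (hδ : 0 < δ) (hδ1 : δ < 1) {T : ℕ}
    (hT : unverifiableTime μ ε₀ i δ < T) :
    8 * complexityH μ ε₀ i * confidenceLevel K T δ + 5 * (K : ℝ) ^ 2 / 2 < T := by
  have hH := complexityH_pos hε₀ hi hin
  have hL := Real.log_nonneg (one_le_one_div hδ hδ1.le)
  rw [unverifiableTime, if_pos hin] at hT
  have hfixed := lt_of_hTwo_lt (by positivity) (one_le_arg_hTwo hK hL (by positivity)) hT
  rw [confidenceLevel]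
  linarith

theorem natCast_le_unverifiableTime (hK : 2 ≤ K) (μ : Fin K → ℝ) {ε₀ : ℝ} (hε₀ : 0 < ε₀) {i : ℕ}
    (hi : 1 ≤ i) {δ : ℝ} (hδ : 0 < δ) (hδ1 : δ < 1) : (K : ℝ) ≤ unverifiableTime μ ε₀ i δ := by
  by_cases hin : i < numClasses μ
  · by_contra! hlt
    have hT := complexityH_mul_confidenceLevel_lt hK hε₀ hi hin hδ hδ1 hlt
    have hH := complexityH_pos hε₀ hi hin
    have hf := one_le_confidenceLevel hK K hδ hδ1
    have hHf : 0 ≤ 8 * complexityH μ ε₀ i * confidenceLevel K K δ := by positivity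
    have hK' : (2 : ℝ) ≤ K := by exact_mod_cast hK
    nlinarith
  · rw [unverifiableTime, if_neg hin]

theorem unverifiableSampleComplexity_le_natCast [MeasurableSpace Ω] {P : Measure Ω}
    [IsProbabilityMeasure P] (F : Filtration ℕ ‹MeasurableSpace Ω›) {μ : Fin K → ℝ}
    {ihat : ℕ → Ω → Fin K} {ε δ : ℝ} {T : ℕ} (hKT : K < T)
    (hT : ENNReal.ofReal (1 - δ) ≤ P {ω | ∀ n, T ≤ n → ihat n ω ∈ goodArms μ ε}) :
    unverifiableSampleComplexity P F μ ihat ε δ ≤ (T : ℝ≥0∞) := by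
  refine (iInf₂_le (fun _ : Ω => (T : ℕ∞)) ⟨isStoppingTime_const F T, fun _ => Nat.cast_lt.2 hKT,
    ?_⟩).trans_eq (by simp)
  simpa only [Nat.cast_le] using hT

end SampleComplexity

namespace IsEBTCRun

variable {Ω : Type*} {K : ℕ} [MeasurableSpace Ω] {P : Measure Ω} [IsProbabilityMeasure P]
  {ν : Fin K → Measure ℝ} [∀ k, IsProbabilityMeasure (ν k)] {ε₀ : ℝ} {ihat C I : ℕ → Ω → Fin K}
  {X : ℕ → Ω → ℝ}

theorem measure_gapIndex_ihat_le (h : IsEBTCRun P ν ε₀ (1 / 2) ihat C I X) (hK : 2 ≤ K)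
    (hsub : ∀ k, IsOneSubGaussian (ν k)) (hε₀ : 0 < ε₀) {i : ℕ} (hi : 1 ≤ i)
    (hin : i < numClasses (armMean ν)) {δ : ℝ} (hδ : 0 < δ) (hδ1 : δ < 1) {T : ℕ}
    (hT : unverifiableTime (armMean ν) ε₀ i δ < T) :
    ENNReal.ofReal (1 - δ) ≤ P {ω | ∀ n, T ≤ n → gapIndex (armMean ν) (ihat n ω) ≤ i} := by
  have hKT : K < T := by
    exact_mod_cast (natCast_le_unverifiableTime hK (armMean ν) hε₀ hi hδ hδ1).trans_lt hT
  have hf := one_le_confidenceLevel hK T hδ hδ1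
  have hcount := complexityH_mul_confidenceLevel_lt hK hε₀ hi hin hδ hδ1 hT
  obtain ⟨j, hj, hji, hH⟩ := exists_complexityH_eq (armMean ν) ε₀ hi
  have hH_pos := complexityH_pos hε₀ hi hin
  have hK' : (2 : ℝ) ≤ K := by exact_mod_cast hK
  have hT_tilde : 1 + 4 * hTilde (armMean ν) ε₀ i j ≤ T := by
    have hle : hTilde (armMean ν) ε₀ i j ≤ complexityH (armMean ν) ε₀ i := by
      rw [hH]
      exact le_max_right _ _
    linarith [le_mul_of_one_le_right hH_pos.le hf, pow_le_pow_left₀ zero_le_two hK' 2]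
  have hfail := h.isBanditRun.measure_compl_isConcentrated_le h.init hsub T (zero_le_one.trans hf)
    (errorSign_sq (armMean ν) i)
    (fun k => (half_pos (sub_pos.2 (strictMonoOn_sortedGap (armMean ν) ⟨hj, by omega⟩
      ⟨by omega, hin⟩ (by omega)))).trans_le (half_sub_le_errorMargin (armMean ν) i j k))
    (one_add_one_div_errorMargin_sq_le hj hji hin hT_tilde)
  rw [mul_exp_neg_confidenceLevel (by omega) (by omega) hδ] at hfail
  rw [hH] at hcount
  calc ENNReal.ofReal (1 - δ) = 1 - ENNReal.ofReal δ := by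
        rw [ENNReal.ofReal_sub _ hδ.le, ENNReal.ofReal_one]
    _ ≤ P {ω | IsConcentrated (armMean ν) I X T (confidenceLevel K T δ) (errorSign (armMean ν) i)
          (errorMargin (armMean ν) i j) ω} := by
        refine tsub_le_iff_right.2 (le_trans ?_ (add_le_add_right hfail _))
        rw [← measure_univ (μ := P), ← Set.union_compl_self]
        exact measure_union_le _ _
    _ ≤ P {ω | ∀ n, T ≤ n → gapIndex (armMean ν) (ihat n ω) ≤ i} :=
        measure_mono fun ω hω n hn =>
          h.gapIndex_ihat_le hε₀ hj hji hin hKT (zero_lt_one.trans_le hf) hcount hω hn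

theorem measure_ihat_mem_goodArms (h : IsEBTCRun P ν ε₀ (1 / 2) ihat C I X) (hK : 2 ≤ K)
    (hsub : ∀ k, IsOneSubGaussian (ν k)) (hε₀ : 0 < ε₀) {δ : ℝ} (hδ : 0 < δ) (hδ1 : δ < 1)
    {ε : ℝ} (hε : 0 ≤ ε) :
    ENNReal.ofReal (1 - δ) ≤ P {ω | ∀ n : ℕ,
      unverifiableTime (armMean ν) ε₀ (classIndex (armMean ν) ε) δ < n →
        ihat n ω ∈ goodArms (armMean ν) ε} := by
  have hi := one_le_classIndex (by omega) (armMean ν) ε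
  rcases lt_or_ge (classIndex (armMean ν) ε) (numClasses (armMean ν)) with hin | hin
  · have hU : 0 ≤ unverifiableTime (armMean ν) ε₀ (classIndex (armMean ν) ε) δ :=
      (Nat.cast_nonneg K).trans (natCast_le_unverifiableTime hK _ hε₀ hi hδ hδ1)
    refine (h.measure_gapIndex_ihat_le hK hsub hε₀ hi hin hδ hδ1
      (by exact_mod_cast Nat.lt_floor_add_one _)).trans (measure_mono fun ω hω n hn => ?_)
    exact mem_goodArms_of_gapIndex_le_classIndex hin (hω n ((Nat.floor_lt hU).2 hn))
  · simp [mem_goodArms_of_numClasses_le_classIndex hε hin, hδ.le]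

end IsEBTCRun

theorem mainTheorem5 {Ω : Type*} [mΩ : MeasurableSpace Ω] (P : Measure Ω) [IsProbabilityMeasure P]
    {K : ℕ} (hK : 2 ≤ K)
    (ν : Fin K → Measure ℝ) (hprob : ∀ k, IsProbabilityMeasure (ν k))
    (hsub : ∀ k, IsOneSubGaussian (ν k))
    (ε₀ : ℝ) (hε₀ : 0 < ε₀)
    (ihat C I : ℕ → Ω → Fin K) (X : ℕ → Ω → ℝ)
    (hrun : IsEBTCRun P ν ε₀ (1 / 2) ihat C I X) :
    (∀ δ : ℝ, 0 < δ → δ < 1 → ∀ ε : ℝ, 0 ≤ ε →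
      ENNReal.ofReal (1 - δ) ≤
          P {ω | ∀ n : ℕ,
            unverifiableTime (armMean ν) ε₀ (classIndex (armMean ν) ε) δ < (n : ℝ) →
              ihat n ω ∈ goodArms (armMean ν) ε}
        ∧ unverifiableSampleComplexity P
            (history I X hrun.measurable_arm hrun.measurable_reward) (armMean ν) ihat ε δ
          ≤ ((⌊unverifiableTime (armMean ν) ε₀ (classIndex (armMean ν) ε) δ⌋₊ + 1 : ℕ) : ℝ≥0∞))
    ∧ (∀ i : ℕ, 1 ≤ i → i < numClasses (armMean ν) →
        (fun δ : ℝ => unverifiableTime (armMean ν) ε₀ i δ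
            - 8 * complexityH (armMean ν) ε₀ i * Real.log (1 / δ))
          =O[𝓝[>] 0] fun δ : ℝ => Real.log (Real.log (1 / δ)))
    ∧ (∀ A B : ℝ, 0 < A →
        (fun δ : ℝ => hTwo (Real.log (1 / δ)) A B - A * Real.log (1 / δ))
          =O[𝓝[>] 0] fun δ : ℝ => Real.log (Real.log (1 / δ))) := by
  refine ⟨fun δ hδ hδ1 ε hε => ?_, fun i hi hin => ?_, hTwo_sub_isBigO⟩
  · have hmeasure := hrun.measure_ihat_mem_goodArms hK hsub hε₀ hδ hδ1 hε
    have hKU := natCast_le_unverifiableTime hK (armMean ν) hε₀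
      (one_le_classIndex (by omega) (armMean ν) ε) hδ hδ1
    refine ⟨hmeasure, unverifiableSampleComplexity_le_natCast _
      (Nat.lt_succ_of_le (Nat.le_floor hKU)) (hmeasure.trans (measure_mono fun ω hω n hn => ?_))⟩
    exact hω n (Nat.lt_of_floor_lt hn)
  · have hH := complexityH_pos hε₀ hi hin
    simp only [unverifiableTime, if_pos hin]
    exact hTwo_sub_isBigO _ _ (by positivity)
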